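/- Let $d\ge 1$ and let $\pi$ be a probability measure on $\mathbb{Z}^d$ whose support is exactly $\{\pm e_1,\dots,\pm e_d\}$, the set of natural generators. Let $\pi^{(n)}$ be the $n$-fold convolution power of $\pi$ (with $\pi^{(0)}=\delta_{\mathbf 0}$), let $$G_d(z)=\sum_{n\ge 0}\pi^{(n)}(\mathbf 0)\,z^n ,\qquad z\in\mathbb{C},$$ be the Green function of the associated random walk, and let $\varrho_d$ be the radius of convergence of this power series. Then $0<\varrho_d<\infty$, and there are complex functions $f,g$, analytic in a neighbourhood of $\varrho_d$, with $g(\varrho_d)\neq 0$, such that, for all $z\in\mathbb{C}$ in some neighbourhood of $\varrho_d$ at which the series $G_d(z)$ converges absolutely (in particular for all $z$ in this neighbourhood with $|z|<\varrho_d$), $$G_d(z)=\begin{cases} f(z)+g(z)\,(\varrho_d-z)^{(d-2)/2}, & \text{if } d \text{ is odd},\\[1ex] f(z)+g(z)\,(\varrho_d-z)^{(d-2)/2}\,\log(\varrho_d-z), & \text{if } d \text{ is even,}\end{cases}$$ where the power and the logarithm are principal branches. At $z=\varrho_d$ (where the series converges absolutely only if $d\geq 3$) the singular term is read as its limit $0$.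 -/

import Mathlib

open MeasureTheory Filter Topology
open scoped ENNReal

/-- The natural generators `± e₁, …, ± e_d` of `ℤ^d`. -/
def naturalGenerators (d : ℕ) : Set (Fin d → ℤ) :=
  {x | ∃ i : Fin d, x = Pi.single i 1 ∨ x = -Pi.single i 1}

/-- `π` is the step distribution of a nearest neighbour random walk on `ℤ^d`: the set of points of
positive mass is exactly `{± e₁, …, ± e_d}`. -/
def IsNearestNeighbour {d : ℕ} (π : Measure (Fin d → ℤ)) : Prop :=
  {x | π {x} ≠ 0} = naturalGenerators d

/-- The `n`-fold convolution power `π^{(n)}`: the law at time `n` of the random walk with step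
distribution `π` started at the origin. -/
noncomputable def convPower {d : ℕ} (π : Measure (Fin d → ℤ)) : ℕ → Measure (Fin d → ℤ)
  | 0 => Measure.dirac 0
  | n + 1 => (convPower π n).conv π

/-- The `n`-step return probability `π^{(n)}(0)`. -/
noncomputable def returnProb {d : ℕ} (π : Measure (Fin d → ℤ)) (n : ℕ) : ℝ :=
  (convPower π n).real {0}

/-- The Green function `z ↦ ∑_{n ≥ 0} π^{(n)}(0) zⁿ`. -/
noncomputable def greenFunction {d : ℕ} (π : Measure (Fin d → ℤ)) (z : ℂ) : ℂ :=
  ∑' n : ℕ, (returnProb π n : ℂ) * z ^ n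

/-- The radius of convergence of the power series `∑_{n ≥ 0} π^{(n)}(0) zⁿ`. -/
noncomputable def greenRadius {d : ℕ} (π : Measure (Fin d → ℤ)) : ℝ≥0∞ :=
  (FormalMultilinearSeries.ofScalars ℂ (fun n : ℕ => (returnProb π n : ℂ))).radius

/-! Write `u i`, `v i` for the masses of `e_i` and `-e_i`. The exponential tilt `x ↦ ∏ r_i ^ x_i`
with `r_i = √(u i / v i)` replaces both masses by `a_i = √(u i * v i)` and does not change return
probabilities, since it equals 1 at the origin. Fourier inversion then gives `π^{(n)}(0) = E[(S -
Y)^n]`, where `S = ∑ 2 a_i` and `Y = ∑ 2 a_i (1 - cos 2πθ_i)` for independent uniform angles `θ_i`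
(`exists_returnProb_eq_integral`).

Each summand of `Y` has an arcsine law, with density `x^(-1/2)` times a holomorphic function near 0.
Under convolution exponents add and holomorphic factors stay holomorphic (`HasPowerDensity.conv`),
so near 0 the law of `Y` has density `x^(d/2 - 1) H(x)` with `H` holomorphic and `H 0 ≠ 0`.

Summing the geometric series, `G(z) = z⁻¹ E[(ε + Y)⁻¹]` with `ε = z⁻¹ - S`: a Cauchy transform near
the endpoint of the support. Only the mass of `Y` near 0 matters for its singularity at `ε = 0`.
Freezing `H` at `-ε` costs an analytic error, and the transform of the pure power `s^(k/2 - 1)` is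
computed explicitly for `k = 1, 2` and by a recurrence `k → k + 2` afterwards
(`integral_rpow_mul_inv_eq`). Finally `ε = (ρ - z) S / z` with `ρ = 1 / S`, so the singularity in
`ε` becomes one in `ρ - z` up to analytic factors.

The radius is exactly `1 / S`, because `|S - Y| ≤ S` and `Y` charges every neighbourhood of 0.
Points of convergence on the boundary circle are reached by Abel's theorem
(`expansion_of_summable`). -/

/-! ### Holomorphic parametric integrals -/

open Metric in
/-- A parametric integral of holomorphic functions with a locally uniform integrable bound is
holomorphic. -/
lemma differentiableAt_integral_of_norm_le {T : Type*} [MeasurableSpace T] {μ : Measure T}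
    {F : ℂ → T → ℂ} {z₀ : ℂ} {r : ℝ} (hr : 0 < r) {b : T → ℝ} (hb : Integrable b μ)
    (hm : ∀ z ∈ ball z₀ r, AEStronglyMeasurable (F z) μ)
    (hd : ∀ᵐ t ∂μ, DifferentiableOn ℂ (F · t) (ball z₀ r))
    (hle : ∀ᵐ t ∂μ, ∀ z ∈ ball z₀ r, ‖F z t‖ ≤ b t) :
    DifferentiableAt ℂ (fun z => ∫ t, F z t ∂μ) z₀ := by
  have hz₀ : z₀ ∈ ball z₀ r := mem_ball_self hr
  -- Measurability of the derivative in `t` is not assumed; it is inherited from the difference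
  -- quotients along this sequence of points tending to `z₀`.
  have hu : Tendsto (fun n : ℕ => z₀ + ((r / 2 * (1 / ((n : ℝ) + 1)) : ℝ) : ℂ)) atTop
      (𝓝[≠] z₀) := by
    refine tendsto_nhdsWithin_iff.2 ⟨?_, Eventually.of_forall fun n => ?_⟩
    · have h1 := (tendsto_one_div_add_atTop_nhds_zero_nat (𝕜 := ℝ)).const_mul (r / 2)
      have h2 := (Complex.continuous_ofReal.tendsto _).comp h1
      simpa using h2.const_add z₀
    · have : r / 2 * (1 / ((n : ℝ) + 1)) ≠ 0 := by positivity
      simpa only [Set.mem_compl_iff, Set.mem_singleton_iff, add_eq_left, Complex.ofReal_eq_zero]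
  have hmem : ∀ n : ℕ, z₀ + ((r / 2 * (1 / ((n : ℝ) + 1)) : ℝ) : ℂ) ∈ ball z₀ r := by
    intro n
    rw [mem_ball, dist_eq_norm, add_sub_cancel_left, Complex.norm_real, Real.norm_of_nonneg
      (by positivity)]
    have : 1 / ((n : ℝ) + 1) ≤ 1 := by
      rw [div_le_one (by positivity)]; linarith [Nat.cast_nonneg (α := ℝ) n]
    nlinarith
  have hF'm : AEStronglyMeasurable (fun t => deriv (F · t) z₀) μ := by
    refine aestronglyMeasurable_of_tendsto_ae atTop
      (f := fun n : ℕ => fun t => slope (F · t) z₀ (z₀ + ((r / 2 * (1 / ((n : ℝ) + 1)) : ℝ) : ℂ)))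
      (fun n => ?_) ?_
    · simp only [slope_def_field, div_eq_mul_inv]
      exact ((hm _ (hmem n)).sub (hm _ hz₀)).mul_const _
    · filter_upwards [hd] with t ht
      exact (ht.differentiableAt (isOpen_ball.mem_nhds hz₀)).hasDerivAt.tendsto_slope.comp hu
  refine (hasDerivAt_integral_of_dominated_loc_of_deriv_le (s := ball z₀ (r / 2))
    (ball_mem_nhds _ (by positivity)) ?_ ?_ (F' := fun z t => deriv (F · t) z) hF'm
    (bound := fun t => b t / (r / 4)) ?_ (hb.div_const _) ?_).2.differentiableAt
  · filter_upwards [ball_mem_nhds z₀ hr] with z hz using hm z hz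
  · exact hb.mono' (hm _ hz₀) (hle.mono fun t ht => ht _ hz₀)
  · filter_upwards [hd, hle] with t hdt hlt z hz
    -- Circles of radius `r / 4` centred in the ball of radius `r / 2` stay inside the ball of
    -- radius `r`, so Cauchy's estimate gives the dominating function `b t / (r / 4)`.
    have hsub : closedBall z (r / 4) ⊆ ball z₀ r := fun w hw => by
      rw [mem_ball] at hz ⊢
      rw [mem_closedBall] at hw
      linarith [dist_triangle w z z₀]
    refine Complex.norm_deriv_le_of_forall_mem_sphere_norm_le (by positivity) ?_ fun w hw =>
      hlt w (hsub (sphere_subset_closedBall hw))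
    refine DifferentiableOn.diffContOnCl (hdt.mono ?_)
    exact (closure_ball_subset_closedBall).trans hsub
  · filter_upwards [hd] with t hdt z hz
    exact (hdt.differentiableAt (isOpen_ball.mem_nhds
      (ball_subset_ball (by linarith) hz))).hasDerivAt

open Metric in
lemma differentiableOn_integral_of_norm_le {T : Type*} [MeasurableSpace T] {μ : Measure T}
    {F : ℂ → T → ℂ} {U : Set ℂ} (hU : IsOpen U) {b : T → ℝ} (hb : Integrable b μ)
    (hm : ∀ z ∈ U, AEStronglyMeasurable (F z) μ)
    (hd : ∀ᵐ t ∂μ, DifferentiableOn ℂ (F · t) U)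
    (hle : ∀ᵐ t ∂μ, ∀ z ∈ U, ‖F z t‖ ≤ b t) :
    DifferentiableOn ℂ (fun z => ∫ t, F z t ∂μ) U := by
  intro z hz
  obtain ⟨r, hr, hsub⟩ := isOpen_iff.1 hU z hz
  exact (differentiableAt_integral_of_norm_le hr hb (fun w hw => hm w (hsub hw))
    (hd.mono fun t ht => ht.mono hsub)
    (hle.mono fun t ht w hw => ht w (hsub hw))).differentiableWithinAt

/-! ### The model singularity and Cauchy transforms of pure powers -/

/-- The model singularity `z ^ ((k - 2) / 2)`, with an additional logarithm if `k` is even. -/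
noncomputable def modelSingularity (k : ℕ) (z : ℂ) : ℂ :=
  if Odd k then z ^ (((k : ℂ) - 2) / 2) else z ^ (((k : ℂ) - 2) / 2) * Complex.log z

lemma modelSingularity_add_two (k : ℕ) {z : ℂ} (hz : z ≠ 0) :
    modelSingularity (k + 2) z = z * modelSingularity k z := by
  have h : z ^ ((((k + 2 : ℕ) : ℂ) - 2) / 2) = z * z ^ (((k : ℂ) - 2) / 2) := by
    rw [show (((k + 2 : ℕ) : ℂ) - 2) / 2 = ((k : ℂ) - 2) / 2 + 1 by push_cast; ring,
      Complex.cpow_add _ _ hz, Complex.cpow_one, mul_comm]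
  unfold modelSingularity
  have h2 : Odd (k + 2) ↔ Odd k := by simp [Nat.odd_add]
  simp only [h2, h]
  split_ifs <;> ring

lemma modelSingularity_one {z : ℂ} : modelSingularity 1 z = (z ^ (1 / 2 : ℂ))⁻¹ := by
  rw [modelSingularity, if_pos odd_one, ← Complex.cpow_neg]
  norm_num

lemma modelSingularity_two {z : ℂ} : modelSingularity 2 z = Complex.log z := by
  rw [modelSingularity, if_neg (by decide)]
  simp

lemma add_ofReal_mem_slitPlane {z : ℂ} (hz : z ∈ Complex.slitPlane) {s : ℝ} (hs : 0 ≤ s) :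
    z + s ∈ Complex.slitPlane := by
  rw [Complex.mem_slitPlane_iff] at hz ⊢
  simp only [Complex.add_re, Complex.ofReal_re, Complex.add_im, Complex.ofReal_im, add_zero]
  exact hz.imp (fun h => by linarith) id

lemma cpow_half_re_pos {z : ℂ} (hz : z ∈ Complex.slitPlane) : 0 < (z ^ (1 / 2 : ℂ)).re := by
  have h0 := Complex.slitPlane_ne_zero hz
  rw [Complex.cpow_def_of_ne_zero h0, Complex.exp_re]
  refine mul_pos (Real.exp_pos _) (Real.cos_pos_of_mem_Ioo ?_)
  have h1 := Complex.neg_pi_lt_arg z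
  have h2 := (Complex.arg_le_pi z).lt_of_ne (Complex.mem_slitPlane_iff_arg.1 hz).1
  have : (Complex.log z * (1 / 2)).im = z.arg / 2 := by
    rw [show (1 / 2 : ℂ) = ((1 / 2 : ℝ) : ℂ) by norm_num, Complex.im_mul_ofReal, Complex.log_im]
    ring
  rw [this]
  constructor <;> linarith

lemma cpow_half_sq (z : ℂ) : (z ^ (1 / 2 : ℂ)) ^ 2 = z := by
  rw [← Complex.cpow_nat_mul]; norm_num

lemma log_neg_of_im_pos {w : ℂ} (hw : 0 < w.im) :
    Complex.log (-w) = Complex.log w - Real.pi * Complex.I := by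
  rw [Complex.log, Complex.log, norm_neg, Complex.arg_neg_eq_arg_sub_pi_of_im_pos hw]
  push_cast; ring

lemma intervalIntegrable_rpow_mul_inv {R : ℝ} (hR : 0 < R) {α : ℝ} (hα : 0 < α) {z : ℂ}
    (hz : z ∈ Complex.slitPlane) :
    IntervalIntegrable (fun s : ℝ => ((s ^ (α - 1) : ℝ) : ℂ) * (z + s)⁻¹) volume 0 R := by
  refine IntervalIntegrable.mul_continuousOn
    ⟨(intervalIntegral.intervalIntegrable_rpow' (by linarith)).1.ofReal,
      (intervalIntegral.intervalIntegrable_rpow' (by linarith)).2.ofReal⟩ ?_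
  refine ContinuousOn.inv₀ (by fun_prop) fun s hs => ?_
  rw [Set.uIcc_of_le hR.le] at hs
  exact Complex.slitPlane_ne_zero (add_ofReal_mem_slitPlane hz hs.1)

lemma integral_inv_add_ofReal {R : ℝ} (hR : 0 < R) {z : ℂ} (hz : z ∈ Complex.slitPlane) :
    ∫ s in (0 : ℝ)..R, (z + s)⁻¹ = Complex.log (z + R) - Complex.log z := by
  have := intervalIntegral.integral_eq_sub_of_hasDerivAt (a := 0) (b := R)
    (f := fun s : ℝ => Complex.log (z + s)) (f' := fun s : ℝ => (z + s)⁻¹) (fun s hs => ?_) ?_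
  · simpa using this
  · rw [Set.uIcc_of_le hR.le] at hs
    have h1 : HasDerivAt (fun s : ℝ => z + (s : ℂ)) 1 s :=
      (Complex.ofRealCLM.hasDerivAt (x := s)).const_add z
    simpa using h1.clog_real (add_ofReal_mem_slitPlane hz hs.1)
  · refine ContinuousOn.intervalIntegrable (ContinuousOn.inv₀ (by fun_prop) fun s hs => ?_)
    rw [Set.uIcc_of_le hR.le] at hs
    exact Complex.slitPlane_ne_zero (add_ofReal_mem_slitPlane hz hs.1)

/-- The left side is odd in `η`. Pulling out `-iη` leaves an integral depending on `η ^ 2` only,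
which for `η = √z` is analytic in `z` near 0. -/
lemma log_sub_log_eq_integral {L : ℝ} (hL : 0 < L) {η : ℂ} (hη : 0 < η.re) :
    Complex.log (L - Complex.I * η) - Complex.log (L + Complex.I * η) =
      -(Complex.I * η) * ∫ t in (0 : ℝ)..1, 2 * (L : ℂ) * (L ^ 2 + η ^ 2 * (t : ℂ) ^ 2)⁻¹ := by
  have hs1 : ∀ t : ℝ, 0 ≤ t → (L : ℂ) - Complex.I * η * t ∈ Complex.slitPlane := by
    intro t ht
    rw [Complex.mem_slitPlane_iff]
    rcases ht.eq_or_lt with rfl | ht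
    · left; simpa using hL
    · right; simp [ht.ne', hη.ne']
  have hs2 : ∀ t : ℝ, 0 ≤ t → (L : ℂ) + Complex.I * η * t ∈ Complex.slitPlane := by
    intro t ht
    rw [Complex.mem_slitPlane_iff]
    rcases ht.eq_or_lt with rfl | ht
    · left; simpa using hL
    · right; simp [ht.ne', hη.ne']
  have hfac : ∀ t : ℝ, (L : ℂ) ^ 2 + η ^ 2 * (t : ℂ) ^ 2 =
      (L - Complex.I * η * t) * (L + Complex.I * η * t) := by
    intro t; linear_combination (η ^ 2 * (t : ℂ) ^ 2) * Complex.I_sq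
  have hne : ∀ t : ℝ, 0 ≤ t → (L : ℂ) ^ 2 + η ^ 2 * (t : ℂ) ^ 2 ≠ 0 := fun t ht => by
    rw [hfac]
    exact mul_ne_zero (Complex.slitPlane_ne_zero (hs1 t ht)) (Complex.slitPlane_ne_zero (hs2 t ht))
  rw [← intervalIntegral.integral_const_mul]
  have := intervalIntegral.integral_eq_sub_of_hasDerivAt (a := 0) (b := 1)
    (f := fun t : ℝ => Complex.log (L - Complex.I * η * t) - Complex.log (L + Complex.I * η * t))
    (f' := fun t : ℝ => -(Complex.I * η) * (2 * (L : ℂ) * (L ^ 2 + η ^ 2 * (t : ℂ) ^ 2)⁻¹))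
    (fun t ht => ?_) ?_
  · rw [this]; simp
  · rw [Set.uIcc_of_le zero_le_one] at ht
    have hI : HasDerivAt (fun s : ℝ => Complex.I * η * (s : ℂ)) (Complex.I * η) t := by
      simpa using (Complex.ofRealCLM.hasDerivAt (x := t)).const_mul (Complex.I * η)
    have h1 := (hI.const_sub (L : ℂ)).clog_real (hs1 t ht.1)
    have h2 := (hI.const_add (L : ℂ)).clog_real (hs2 t ht.1)
    convert! h1.sub h2 using 1
    rw [hfac]
    have e1 := Complex.slitPlane_ne_zero (hs1 t ht.1)
    have e2 := Complex.slitPlane_ne_zero (hs2 t ht.1)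
    field_simp
    ring
  · refine ContinuousOn.intervalIntegrable (ContinuousOn.mul (by fun_prop) (ContinuousOn.mul
      (by fun_prop) (ContinuousOn.inv₀ (by fun_prop) fun s hs => ?_)))
    rw [Set.uIcc_of_le zero_le_one] at hs
    exact hne s hs.1

/-- With `η = √z`, a primitive is `(iη)⁻¹ (log(√s - iη) - log(√s + iη))`. The endpoint `R` gives the
part analytic in `z`; at `s = 0` the two logarithms differ by `-πi`, which produces the singular
term `π / η`. -/
lemma integral_rpow_neg_half_mul_inv {R : ℝ} (hR : 0 < R) {z : ℂ} (hz : z ∈ Complex.slitPlane) :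
    ∫ s in (0 : ℝ)..R, ((s ^ ((1 / 2 : ℝ) - 1) : ℝ) : ℂ) * (z + s)⁻¹ =
      -(∫ t in (0 : ℝ)..1, 2 * (√R : ℂ) * ((√R : ℂ) ^ 2 + z * (t : ℂ) ^ 2)⁻¹) +
        Real.pi * (z ^ (1 / 2 : ℂ))⁻¹ := by
  set η := z ^ (1 / 2 : ℂ) with hηdef
  have hη : 0 < η.re := cpow_half_re_pos hz
  have hη2 : η ^ 2 = z := cpow_half_sq z
  have hη0 : η ≠ 0 := fun h => by simp [h] at hη
  have hs1 : ∀ t : ℝ, (t : ℂ) - Complex.I * η ∈ Complex.slitPlane := fun t => by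
    rw [Complex.mem_slitPlane_iff]; right; simp [hη.ne']
  have hs2 : ∀ t : ℝ, (t : ℂ) + Complex.I * η ∈ Complex.slitPlane := fun t => by
    rw [Complex.mem_slitPlane_iff]; right; simp [hη.ne']
  have key := intervalIntegral.integral_eq_sub_of_hasDerivAt_of_le hR.le
    (f := fun s : ℝ => (Complex.I * η)⁻¹ *
      (Complex.log ((√s : ℝ) - Complex.I * η) - Complex.log ((√s : ℝ) + Complex.I * η)))
    (f' := fun s : ℝ => ((s ^ ((1 / 2 : ℝ) - 1) : ℝ) : ℂ) * (z + s)⁻¹) ?_ (fun s hs => ?_)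
    (intervalIntegrable_rpow_mul_inv hR (by norm_num) hz)
  · rw [key, log_sub_log_eq_integral (Real.sqrt_pos.2 hR) hη, hη2]
    simp only [Real.sqrt_zero, Complex.ofReal_zero, zero_sub, zero_add]
    rw [log_neg_of_im_pos (by simpa using hη)]
    have := Complex.I_ne_zero
    field_simp
    ring
  · have hc : Continuous fun s : ℝ => ((√s : ℝ) : ℂ) :=
      Complex.continuous_ofReal.comp Real.continuous_sqrt
    refine (continuous_const.mul (Continuous.sub ?_ ?_)).continuousOn
    · exact (hc.sub continuous_const).clog fun s => hs1 _
    · exact (hc.add continuous_const).clog fun s => hs2 _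
  · have hs0 : 0 < √s := Real.sqrt_pos.2 hs.1
    have hsq : HasDerivAt (fun s : ℝ => ((√s : ℝ) : ℂ)) ((1 / (2 * √s) : ℝ) : ℂ) s :=
      (Real.hasDerivAt_sqrt hs.1.ne').ofReal_comp
    have h1 := (hsq.sub_const (Complex.I * η)).clog_real (hs1 _)
    have h2 := (hsq.add_const (Complex.I * η)).clog_real (hs2 _)
    convert! (h1.sub h2).const_mul (Complex.I * η)⁻¹ using 1
    have e1 := Complex.slitPlane_ne_zero (hs1 √s)
    have e2 := Complex.slitPlane_ne_zero (hs2 √s)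
    have hfac : z + s = ((√s : ℝ) - Complex.I * η) * ((√s : ℝ) + Complex.I * η) := by
      have : (s : ℂ) = ((√s : ℝ) : ℂ) ^ 2 := by
        rw [← Complex.ofReal_pow, Real.sq_sqrt hs.1.le]
      rw [this, ← hη2]
      linear_combination (η ^ 2) * Complex.I_sq
    have hpow : s ^ ((1 / 2 : ℝ) - 1) = (√s)⁻¹ := by
      rw [Real.sqrt_eq_rpow, ← Real.rpow_neg hs.1.le]; norm_num
    rw [hfac, hpow]
    have hs0' : ((√s : ℝ) : ℂ) ≠ 0 := by exact_mod_cast hs0.ne'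
    have := Complex.I_ne_zero
    push_cast
    field_simp
    ring

/-- For `|z| < L² / 2` and `0 < t ≤ 1` the denominator has modulus at least `L² / 2`. -/
lemma analyticAt_integral_inv_sq_add {L : ℝ} (hL : 0 < L) :
    AnalyticAt ℂ (fun z : ℂ => ∫ t in (0 : ℝ)..1, 2 * (L : ℂ) * ((L : ℂ) ^ 2 + z * (t : ℂ) ^ 2)⁻¹)
      0 := by
  have hL2 : 0 < L ^ 2 / 2 := by positivity
  refine DifferentiableOn.analyticAt (s := Metric.ball 0 (L ^ 2 / 2)) ?_ (Metric.ball_mem_nhds _ hL2)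
  simp only [intervalIntegral.integral_of_le zero_le_one]
  have hlow : ∀ z ∈ Metric.ball (0 : ℂ) (L ^ 2 / 2), ∀ t ∈ Set.Ioc (0 : ℝ) 1,
      L ^ 2 / 2 ≤ ‖(L : ℂ) ^ 2 + z * (t : ℂ) ^ 2‖ := by
    intro z hz t ht
    rw [mem_ball_zero_iff] at hz
    have h1 := norm_sub_le_norm_add ((L : ℂ) ^ 2) (z * (t : ℂ) ^ 2)
    have h2 : ‖(L : ℂ) ^ 2‖ = L ^ 2 := by simp
    have h3 : ‖z * (t : ℂ) ^ 2‖ ≤ ‖z‖ := by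
      rw [norm_mul, norm_pow, Complex.norm_real, Real.norm_of_nonneg ht.1.le]
      exact mul_le_of_le_one_right (norm_nonneg _) (pow_le_one₀ ht.1.le ht.2)
    linarith
  refine differentiableOn_integral_of_norm_le Metric.isOpen_ball
    (b := fun _ => 2 * L * (L ^ 2 / 2)⁻¹) (integrable_const _) ?_ ?_ ?_
  · intro z _
    exact Measurable.aestronglyMeasurable (by fun_prop)
  · filter_upwards [ae_restrict_mem measurableSet_Ioc] with t ht
    refine DifferentiableOn.const_mul (DifferentiableOn.inv (by fun_prop) fun z hz h0 => ?_) _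
    have := hlow z hz t ht
    rw [h0, norm_zero] at this
    linarith
  · filter_upwards [ae_restrict_mem measurableSet_Ioc] with t ht z hz
    have := hlow z hz t ht
    rw [norm_mul, norm_inv, norm_mul, Complex.norm_real, Real.norm_of_nonneg hL.le,
      Complex.norm_ofNat]
    gcongr

/-- The Cauchy transform of `s ^ (k / 2 - 1)` on `(0, R)` is a multiple of the model singularity up
to an analytic function. -/
lemma integral_rpow_mul_inv_eq {R : ℝ} (hR : 0 < R) {k : ℕ} (hk : 1 ≤ k) :
    ∃ (q : ℂ → ℂ) (c : ℂ), AnalyticAt ℂ q 0 ∧ c ≠ 0 ∧ ∀ z ∈ Complex.slitPlane,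
      ∫ s in (0 : ℝ)..R, ((s ^ ((k / 2 : ℝ) - 1) : ℝ) : ℂ) * (z + s)⁻¹ =
        q z + c * modelSingularity k z := by
  obtain ⟨k, rfl⟩ := Nat.exists_eq_add_of_le' hk
  clear hk
  -- After the shift by one, the base cases `zero` and `one` are the exponents `-1/2` and `0`.
  induction k using Nat.twoStepInduction with
  | zero =>
    refine ⟨_, Real.pi, (analyticAt_integral_inv_sq_add (Real.sqrt_pos.2 hR)).neg,
      by exact_mod_cast Real.pi_ne_zero, fun z hz => ?_⟩
    simp only [zero_add, modelSingularity_one, Nat.cast_one]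
    exact integral_rpow_neg_half_mul_inv hR hz
  | one =>
    refine ⟨fun z => Complex.log (z + R), -1, ?_, by norm_num, fun z hz => ?_⟩
    · exact AnalyticAt.clog (by fun_prop) (by simpa using hR)
    · norm_num [modelSingularity_two]
      rw [integral_inv_add_ofReal hR hz]
      ring
  | more k ih _ =>
    obtain ⟨q, c, hq, hc, h⟩ := ih
    refine ⟨fun z => (∫ s in (0 : ℝ)..R, ((s ^ (((k + 1 : ℕ) / 2 : ℝ) - 1) : ℝ) : ℂ)) - z * q z,
      -c, by fun_prop, neg_ne_zero.2 hc, fun z hz => ?_⟩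
    have hα : 0 < ((k + 1 : ℕ) / 2 : ℝ) := by positivity
    have hI : IntervalIntegrable (fun s : ℝ => ((s ^ (((k + 1 : ℕ) / 2 : ℝ) - 1) : ℝ) : ℂ))
        volume 0 R :=
      ⟨(intervalIntegral.intervalIntegrable_rpow' (by linarith)).1.ofReal,
        (intervalIntegral.intervalIntegrable_rpow' (by linarith)).2.ofReal⟩
    rw [show k + 2 + 1 = k + 1 + 2 by ring, modelSingularity_add_two _
      (Complex.slitPlane_ne_zero hz)]
    have hJ := h z hz
    -- The recurrence: `s^α / (z + s) = s^(α-1) - z s^(α-1) / (z + s)`. The first term integrates to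
    -- a constant, and the factor `-z` turns the model singularity for `k` into minus the one for `k
    -- + 2`.
    calc _ = ∫ s in (0 : ℝ)..R, (((s ^ (((k + 1 : ℕ) / 2 : ℝ) - 1) : ℝ) : ℂ) -
          z * (((s ^ (((k + 1 : ℕ) / 2 : ℝ) - 1) : ℝ) : ℂ) * (z + s)⁻¹)) := by
          refine intervalIntegral.integral_congr_ae (ae_of_all _ fun s hs => ?_)
          rw [Set.uIoc_of_le hR.le] at hs
          have hne := Complex.slitPlane_ne_zero (add_ofReal_mem_slitPlane hz hs.1.le)
          rw [show (((k + 1 + 2 : ℕ) : ℝ) / 2 - 1) = (((k + 1 : ℕ) / 2 : ℝ) - 1) + 1 by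
            push_cast; ring, Real.rpow_add_one hs.1.ne']
          push_cast
          field_simp
          ring
      _ = _ := by
          rw [intervalIntegral.integral_sub hI
            ((intervalIntegrable_rpow_mul_inv hR hα hz).const_mul z),
            intervalIntegral.integral_const_mul, hJ]
          ring

/-! ### Cauchy transforms with a holomorphic weight -/

-- The mean value inequality on the convex disc bounds all difference quotients by the supremum of
-- the derivative. The uniformity supplies the dominating function for the remainder integral below.
open Metric in
lemma exists_norm_dslope_le {H : ℂ → ℂ} {R r : ℝ} (hr : r < R)
    (hH : DifferentiableOn ℂ H (ball 0 R)) :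
    ∃ M : ℝ, ∀ x ∈ closedBall (0 : ℂ) r, ∀ y ∈ closedBall (0 : ℂ) r, ‖dslope H x y‖ ≤ M := by
  have hsub : closedBall (0 : ℂ) r ⊆ ball 0 R := closedBall_subset_ball hr
  obtain ⟨M, hM⟩ := (isCompact_closedBall (0 : ℂ) r).exists_bound_of_continuousOn
    ((hH.deriv isOpen_ball).continuousOn.mono hsub)
  refine ⟨M, fun x hx y hy => ?_⟩
  rcases eq_or_ne y x with rfl | hne
  · rw [dslope_same]; exact hM _ hx
  · rw [dslope_of_ne _ hne, slope_def_field, norm_div, div_le_iff₀ (norm_pos_iff.2 (sub_ne_zero.2 hne))]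
    exact (convex_closedBall (0 : ℂ) r).norm_image_sub_le_of_norm_deriv_le
      (fun z hz => hH.differentiableAt (isOpen_ball.mem_nhds (hsub hz))) hM hx hy

lemma dslope_comm (H : ℂ → ℂ) (x y : ℂ) : dslope H x y = dslope H y x := by
  rcases eq_or_ne x y with rfl | hne
  · rfl
  · rw [dslope_of_ne _ hne, dslope_of_ne _ hne.symm, slope_comm]

open Metric in
/-- The Cauchy transform of `s ^ (k / 2 - 1) H(s)` on `(0, r)`, for holomorphic `H`. -/
lemma integral_rpow_mul_holomorphic_mul_inv_eq {H : ℂ → ℂ} {R r : ℝ} (hr0 : 0 < r) (hr : r < R)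
    (hH : DifferentiableOn ℂ H (ball 0 R)) {k : ℕ} (hk : 1 ≤ k) :
    ∃ (q : ℂ → ℂ) (c : ℂ), AnalyticAt ℂ q 0 ∧ c ≠ 0 ∧ ∀ᶠ z in 𝓝 (0 : ℂ), z ∈ Complex.slitPlane →
      ∫ s in (0 : ℝ)..r, ((s ^ ((k / 2 : ℝ) - 1) : ℝ) : ℂ) * H s * (z + s)⁻¹ =
        q z + c * H (-z) * modelSingularity k z := by
  obtain ⟨q, c, hq, hc, hqc⟩ := integral_rpow_mul_inv_eq hr0 hk
  have hα : 0 < (k / 2 : ℝ) := by positivity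
  have hsub : closedBall (0 : ℂ) r ⊆ ball 0 R := closedBall_subset_ball hr
  obtain ⟨M, hM⟩ := exists_norm_dslope_le hr hH
  have hreal : ∀ s ∈ Set.Ioc (0 : ℝ) r, (s : ℂ) ∈ closedBall (0 : ℂ) r := fun s hs => by
    rw [mem_closedBall_zero_iff, Complex.norm_real, Real.norm_of_nonneg hs.1.le]; exact hs.2
  have hneg : ∀ z ∈ ball (0 : ℂ) r, -z ∈ closedBall (0 : ℂ) r := fun z hz => by
    rw [mem_closedBall_zero_iff, norm_neg]; exact (mem_ball_zero_iff.1 hz).le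
  have hI : IntegrableOn (fun s : ℝ => s ^ ((k / 2 : ℝ) - 1)) (Set.Ioc 0 r) :=
    (intervalIntegral.intervalIntegrable_rpow' (by linarith)).1
  have hHm : AEStronglyMeasurable (fun s : ℝ => H s) (volume.restrict (Set.Ioc 0 r)) := by
    refine ContinuousOn.aestronglyMeasurable ?_ measurableSet_Ioc
    exact hH.continuousOn.comp Complex.continuous_ofReal.continuousOn
      fun s hs => hsub (hreal s hs)
  have hKm : ∀ z ∈ ball (0 : ℂ) r, AEStronglyMeasurable
      (fun s : ℝ => ((s ^ ((k / 2 : ℝ) - 1) : ℝ) : ℂ) * dslope H s (-z))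
      (volume.restrict (Set.Ioc 0 r)) := by
    intro z hz
    have h1 : AEStronglyMeasurable (fun s : ℝ => ((s ^ ((k / 2 : ℝ) - 1) : ℝ) : ℂ) *
        ((H s - H (-z)) * ((s : ℂ) + z)⁻¹)) (volume.restrict (Set.Ioc 0 r)) := by
      refine AEStronglyMeasurable.mul (Measurable.aestronglyMeasurable (by fun_prop)) ?_
      exact (hHm.sub aestronglyMeasurable_const).mul
        (Measurable.aestronglyMeasurable (by fun_prop))
    refine h1.congr ?_
    -- The divided difference is the plain quotient except possibly at `s = -z.re`, a null set.
    have : ∀ᵐ s : ℝ ∂(volume.restrict (Set.Ioc 0 r)), s ≠ -z.re := by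
      refine ae_restrict_of_ae ?_
      simp [ae_iff]
    filter_upwards [this] with s hs
    have hne : (s : ℂ) ≠ -z := fun h => hs (by simpa using congrArg Complex.re h)
    rw [dslope_comm, dslope_of_ne _ hne, slope_def_field, sub_neg_eq_add, ← div_eq_mul_inv]
  have hbound : ∀ s ∈ Set.Ioc (0 : ℝ) r, ∀ z ∈ ball (0 : ℂ) r,
      ‖((s ^ ((k / 2 : ℝ) - 1) : ℝ) : ℂ) * dslope H s (-z)‖ ≤ s ^ ((k / 2 : ℝ) - 1) * M := by
    intro s hs z hz
    rw [norm_mul, Complex.norm_real, Real.norm_of_nonneg (Real.rpow_nonneg hs.1.le _)]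
    exact mul_le_mul_of_nonneg_left (hM _ (hreal s hs) _ (hneg z hz)) (Real.rpow_nonneg hs.1.le _)
  have hKa : AnalyticAt ℂ (fun z => ∫ s in Set.Ioc 0 r, ((s ^ ((k / 2 : ℝ) - 1) : ℝ) : ℂ) *
      dslope H s (-z)) 0 := by
    refine DifferentiableOn.analyticAt (s := ball 0 r) ?_ (ball_mem_nhds _ hr0)
    refine differentiableOn_integral_of_norm_le isOpen_ball (hI.mul_const M) hKm ?_ ?_
    · filter_upwards [ae_restrict_mem measurableSet_Ioc] with s hs
      refine DifferentiableOn.const_mul ?_ _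
      have h1 : DifferentiableOn ℂ (dslope H s) (ball 0 R) :=
        (Complex.differentiableOn_dslope (isOpen_ball.mem_nhds (hsub (hreal s hs)))).2 hH
      exact h1.comp differentiableOn_id.neg fun z hz => hsub (hneg z hz)
    · filter_upwards [ae_restrict_mem measurableSet_Ioc] with s hs z hz using hbound s hs z hz
  -- Split `H s = H (-z) + (s + z) * dslope H s (-z)`. The second term cancels the pole and leaves
  -- an analytic integral; the first reduces to the pure power.
  refine ⟨fun z => (∫ s in Set.Ioc 0 r, ((s ^ ((k / 2 : ℝ) - 1) : ℝ) : ℂ) * dslope H s (-z)) +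
    H (-z) * q z, c, ?_, hc, ?_⟩
  · refine hKa.add (AnalyticAt.mul ?_ hq)
    have h1 : AnalyticAt ℂ H (-0) := by
      rw [neg_zero]; exact hH.analyticAt (ball_mem_nhds _ (hr0.trans hr))
    exact h1.comp analyticAt_id.neg
  · filter_upwards [ball_mem_nhds (0 : ℂ) hr0] with z hz hzs
    have hint := intervalIntegrable_rpow_mul_inv hr0 hα hzs
    rw [intervalIntegrable_iff_integrableOn_Ioc_of_le hr0.le] at hint
    have hz' := hqc z hzs
    rw [intervalIntegral.integral_of_le hr0.le] at hz' ⊢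
    calc _ = ∫ s in Set.Ioc 0 r, (((s ^ ((k / 2 : ℝ) - 1) : ℝ) : ℂ) * dslope H s (-z) +
          H (-z) * (((s ^ ((k / 2 : ℝ) - 1) : ℝ) : ℂ) * (z + s)⁻¹)) := by
          refine setIntegral_congr_fun measurableSet_Ioc fun s hs => ?_
          have hne := Complex.slitPlane_ne_zero (add_ofReal_mem_slitPlane hzs hs.1.le)
          have hne' : (s : ℂ) ≠ -z := fun h => hne (by rw [h]; ring)
          rw [dslope_comm, dslope_of_ne _ hne', slope_def_field, sub_neg_eq_add, add_comm (s : ℂ) z]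
          field_simp
          ring
      _ = _ := by
          rw [integral_add ((hI.mul_const M).mono' (hKm z hz) ?_) (hint.const_mul _),
            integral_const_mul, hz']
          · ring
          · filter_upwards [ae_restrict_mem measurableSet_Ioc] with s hs using hbound s hs z hz

/-! ### Measures with a power density at 0, and their convolutions -/

/-- The measure `μ` has no mass on `(-∞, 0)`, and on `(-∞, R)` it has the density
`x ^ (α - 1) H(x)`, `0 < x < R`, for a function `H` that is holomorphic on the disc of radius `R`,
nonnegative on `[0, R)`, and nonzero at `0`. -/
structure HasPowerDensity (μ : Measure ℝ) (α R : ℝ) (H : ℂ → ℂ) : Prop where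
  pos : 0 < R
  differentiableOn : DifferentiableOn ℂ H (Metric.ball 0 R)
  im_eq_zero : ∀ x : ℝ, 0 ≤ x → x < R → (H x).im = 0
  re_nonneg : ∀ x : ℝ, 0 ≤ x → x < R → 0 ≤ (H x).re
  apply_zero_ne : H 0 ≠ 0
  lintegral_eq : ∀ f : ℝ → ℝ≥0∞, Measurable f → (∀ x, R ≤ x → f x = 0) →
    ∫⁻ x, f x ∂μ = ∫⁻ x in Set.Ioo 0 R, f x * ENNReal.ofReal (x ^ (α - 1) * (H x).re)

namespace HasPowerDensity

variable {μ ν : Measure ℝ} {α β R : ℝ} {H A B : ℂ → ℂ}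

lemma mono (h : HasPowerDensity μ α R H) {r : ℝ} (hr0 : 0 < r) (hr : r ≤ R) :
    HasPowerDensity μ α r H where
  pos := hr0
  differentiableOn := h.differentiableOn.mono (Metric.ball_subset_ball hr)
  im_eq_zero x hx hxr := h.im_eq_zero x hx (hxr.trans_le hr)
  re_nonneg x hx hxr := h.re_nonneg x hx (hxr.trans_le hr)
  apply_zero_ne := h.apply_zero_ne
  lintegral_eq f hf hfr := by
    rw [h.lintegral_eq f hf fun x hx => hfr x (hr.trans hx)]
    rw [← lintegral_indicator measurableSet_Ioo, ← lintegral_indicator measurableSet_Ioo]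
    refine lintegral_congr fun x => ?_
    by_cases hx : x < r
    · simp only [Set.indicator, Set.mem_Ioo, hx, hx.trans_le hr, and_true]
    · have := hfr x (not_lt.1 hx)
      simp [Set.indicator, this]

lemma continuousOn (h : HasPowerDensity μ α R H) :
    ContinuousOn (fun x : ℝ => H x) (Set.Ico 0 R) :=
  h.differentiableOn.continuousOn.comp Complex.continuous_ofReal.continuousOn fun x hx => by
    rw [mem_ball_zero_iff, Complex.norm_real, Real.norm_of_nonneg hx.1]; exact hx.2

lemma ae_nonneg (h : HasPowerDensity μ α R H) : ∀ᵐ x ∂μ, 0 ≤ x := by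
  have h1 := h.lintegral_eq (Set.indicator (Set.Iio 0) 1)
    (measurable_one.indicator measurableSet_Iio) fun x hx => by
      simp [h.pos.le.trans hx]
  rw [lintegral_indicator_one measurableSet_Iio, setLIntegral_congr_fun (g := fun _ => 0)
    measurableSet_Ioo (fun x hx => by simp [hx.1.le]), lintegral_zero] at h1
  rw [ae_iff]
  simpa [Set.Iio] using h1

/-- The density, extended by zero. -/
noncomputable def density (α R : ℝ) (H : ℂ → ℂ) : ℝ → ℝ≥0∞ :=
  Set.indicator (Set.Ioo 0 R) fun x => ENNReal.ofReal (x ^ (α - 1) * (H x).re)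

lemma measurable_density (h : HasPowerDensity μ α R H) : Measurable (density α R H) := by
  have h1 : Measurable (Set.indicator (Set.Ioo 0 R) fun x : ℝ => (H x).re) := by
    classical
    have hc : ContinuousOn (fun x : ℝ => (H x).re) (Set.Ioo 0 R) :=
      (Complex.continuous_re.comp_continuousOn h.continuousOn).mono Set.Ioo_subset_Ico_self
    have := hc.measurable_piecewise (g := 0) continuousOn_const measurableSet_Ioo
    rwa [Set.piecewise_eq_indicator] at this
  have h2 : density α R H = fun x => ENNReal.ofReal (x ^ (α - 1) *
      Set.indicator (Set.Ioo 0 R) (fun x : ℝ => (H x).re) x) := by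
    funext x
    simp only [density, Set.indicator]
    split_ifs <;> simp
  rw [h2]
  fun_prop

lemma lintegral_eq_density (h : HasPowerDensity μ α R H) {f : ℝ → ℝ≥0∞} (hf : Measurable f)
    (hfR : ∀ x, R ≤ x → f x = 0) : ∫⁻ x, f x ∂μ = ∫⁻ x, f x * density α R H x := by
  rw [h.lintegral_eq f hf hfR, ← lintegral_indicator measurableSet_Ioo]
  refine lintegral_congr fun x => ?_
  simp only [density, Set.indicator]
  split_ifs <;> simp

/-- Both measures live on `[0, ∞)`, so for a test function vanishing beyond `R` only `x, y < R`
contribute to `f (x + y)`. Knowing the two densities below `R` therefore suffices. -/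
lemma lintegral_conv_eq [SFinite μ] [SFinite ν] (hA : HasPowerDensity μ α R A)
    (hB : HasPowerDensity ν β R B) {f : ℝ → ℝ≥0∞} (hf : Measurable f)
    (hfR : ∀ x, R ≤ x → f x = 0) :
    ∫⁻ x, f x ∂(μ.conv ν) =
      ∫⁻ s, f s * ∫⁻ x, density α R A x * density β R B (s - x) := by
  have mA := hA.measurable_density
  have mB := hB.measurable_density
  rw [Measure.lintegral_conv hf]
  have h1 : ∀ᵐ x ∂μ, ∫⁻ y, f (x + y) ∂ν = ∫⁻ y, f (x + y) * density β R B y := by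
    filter_upwards [hA.ae_nonneg] with x hx
    exact hB.lintegral_eq_density (by fun_prop) fun y hy => hfR _ (by linarith)
  rw [lintegral_congr_ae h1, hA.lintegral_eq_density
    (Measurable.lintegral_prod_right' (f := fun p : ℝ × ℝ => f (p.1 + p.2) * density β R B p.2)
      (by fun_prop))]
  · have h2 : ∀ x, (∫⁻ y, f (x + y) * density β R B y) * density α R A x =
        ∫⁻ s, f s * (density α R A x * density β R B (s - x)) := by
      intro x
      rw [← lintegral_mul_const _ (by fun_prop), ← lintegral_add_left_eq_self _ (-x)]
      refine lintegral_congr fun s => ?_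
      rw [show x + (-x + s) = s by ring, show -x + s = s - x by ring]
      ring
    simp_rw [h2]
    rw [lintegral_lintegral_swap (by fun_prop)]
    refine lintegral_congr fun s => ?_
    rw [lintegral_const_mul _ (by fun_prop)]
  · intro x hx
    rw [lintegral_eq_zero_iff (by fun_prop)]
    refine ae_of_all _ fun y => ?_
    by_cases hy : 0 < y
    · simp [hfR (x + y) (by linarith)]
    · simp [density, hy]

lemma integrableOn_beta (hα : 0 < α) (hβ : 0 < β) :
    IntegrableOn (fun t : ℝ => t ^ (α - 1) * (1 - t) ^ (β - 1)) (Set.Ioo 0 1) := by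
  have h := Complex.betaIntegral_convergent (u := α) (v := β) (by simpa) (by simpa)
  rw [intervalIntegrable_iff_integrableOn_Ioo_of_le zero_le_one] at h
  refine h.re.congr ?_
  filter_upwards [ae_restrict_mem measurableSet_Ioo] with t ht
  have e1 : (t : ℂ) ^ ((α : ℂ) - 1) = ((t ^ (α - 1) : ℝ) : ℂ) := by
    rw [Complex.ofReal_cpow ht.1.le]; push_cast; rfl
  have e2 : (1 - (t : ℂ)) ^ ((β : ℂ) - 1) = (((1 - t) ^ (β - 1) : ℝ) : ℂ) := by
    rw [Complex.ofReal_cpow (by linarith [ht.2])]; push_cast; rfl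
  rw [e1, e2, ← Complex.ofReal_mul]
  rfl

/-- The holomorphic factor of a convolution. -/
noncomputable def convFactor (α β : ℝ) (A B : ℂ → ℂ) (z : ℂ) : ℂ :=
  ∫ t in Set.Ioo (0 : ℝ) 1,
    ((t ^ (α - 1) * (1 - t) ^ (β - 1) : ℝ) : ℂ) * (A (z * t) * B (z * (1 - t : ℝ)))

end HasPowerDensity

namespace HasPowerDensity

variable {μ ν : Measure ℝ} {α β R : ℝ} {H A B : ℂ → ℂ}

lemma mul_ofReal_mem_ball {z : ℂ} {r t : ℝ} (hz : z ∈ Metric.ball (0 : ℂ) r) (ht0 : 0 ≤ t)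
    (ht1 : t ≤ 1) : z * t ∈ Metric.ball (0 : ℂ) r := by
  rw [mem_ball_zero_iff] at hz ⊢
  rw [norm_mul, Complex.norm_real, Real.norm_of_nonneg ht0]
  exact (mul_le_of_le_one_right (norm_nonneg _) ht1).trans_lt hz

lemma exists_norm_le (h : HasPowerDensity μ α R H) {r : ℝ} (hr : r < R) :
    ∃ M, ∀ z ∈ Metric.ball (0 : ℂ) r, ‖H z‖ ≤ M := by
  obtain ⟨M, hM⟩ := (isCompact_closedBall (0 : ℂ) r).exists_bound_of_continuousOn
    (h.differentiableOn.continuousOn.mono (Metric.closedBall_subset_ball hr))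
  exact ⟨M, fun z hz => hM z (Metric.ball_subset_closedBall hz)⟩

lemma aestronglyMeasurable_convFactor_integrand (hA : HasPowerDensity μ α R A)
    (hB : HasPowerDensity ν β R B) {z : ℂ} (hz : z ∈ Metric.ball (0 : ℂ) R) :
    AEStronglyMeasurable (fun t : ℝ => ((t ^ (α - 1) * (1 - t) ^ (β - 1) : ℝ) : ℂ) *
      (A (z * t) * B (z * (1 - t : ℝ)))) (volume.restrict (Set.Ioo (0 : ℝ) 1)) := by
  refine AEStronglyMeasurable.mul (Measurable.aestronglyMeasurable (by fun_prop))
    (AEStronglyMeasurable.mul ?_ ?_)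
  · refine ContinuousOn.aestronglyMeasurable ?_ measurableSet_Ioo
    exact hA.differentiableOn.continuousOn.comp (by fun_prop) fun t ht =>
      mul_ofReal_mem_ball hz ht.1.le ht.2.le
  · refine ContinuousOn.aestronglyMeasurable ?_ measurableSet_Ioo
    exact hB.differentiableOn.continuousOn.comp (by fun_prop) fun t ht =>
      mul_ofReal_mem_ball hz (sub_nonneg.2 ht.2.le) (by linarith [ht.1])

lemma norm_convFactor_integrand_le {r MA MB : ℝ} (hMA : ∀ z ∈ Metric.ball (0 : ℂ) r, ‖A z‖ ≤ MA)
    (hMB : ∀ z ∈ Metric.ball (0 : ℂ) r, ‖B z‖ ≤ MB) {t : ℝ} (ht : t ∈ Set.Ioo (0 : ℝ) 1) {z : ℂ}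
    (hz : z ∈ Metric.ball (0 : ℂ) r) :
    ‖((t ^ (α - 1) * (1 - t) ^ (β - 1) : ℝ) : ℂ) * (A (z * t) * B (z * (1 - t : ℝ)))‖ ≤
      t ^ (α - 1) * (1 - t) ^ (β - 1) * (MA * MB) := by
  have h1 : 0 ≤ t ^ (α - 1) * (1 - t) ^ (β - 1) :=
    mul_nonneg (Real.rpow_nonneg ht.1.le _) (Real.rpow_nonneg (by linarith [ht.2]) _)
  have h2 := hMA _ (mul_ofReal_mem_ball hz ht.1.le ht.2.le)
  have h3 := hMB _ (mul_ofReal_mem_ball hz (sub_nonneg.2 ht.2.le) (by linarith [ht.1]))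
  rw [norm_mul, norm_mul, Complex.norm_real, Real.norm_of_nonneg h1]
  exact mul_le_mul_of_nonneg_left (mul_le_mul h2 h3 (norm_nonneg _) ((norm_nonneg _).trans h2)) h1

lemma differentiableOn_convFactor (hα : 0 < α) (hβ : 0 < β) (hA : HasPowerDensity μ α R A)
    (hB : HasPowerDensity ν β R B) {r : ℝ} (hr : r < R) :
    DifferentiableOn ℂ (convFactor α β A B) (Metric.ball 0 r) := by
  obtain ⟨MA, hMA⟩ := hA.exists_norm_le hr
  obtain ⟨MB, hMB⟩ := hB.exists_norm_le hr
  have hsub : Metric.ball (0 : ℂ) r ⊆ Metric.ball 0 R := Metric.ball_subset_ball hr.le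
  refine differentiableOn_integral_of_norm_le Metric.isOpen_ball
    ((integrableOn_beta hα hβ).mul_const (MA * MB))
    (fun z hz => aestronglyMeasurable_convFactor_integrand hA hB (hsub hz)) ?_ ?_
  · filter_upwards [ae_restrict_mem measurableSet_Ioo] with t ht
    refine DifferentiableOn.const_mul (DifferentiableOn.mul ?_ ?_) _
    · exact hA.differentiableOn.comp (by fun_prop) fun z hz =>
        mul_ofReal_mem_ball (hsub hz) ht.1.le ht.2.le
    · exact hB.differentiableOn.comp (by fun_prop) fun z hz =>
        mul_ofReal_mem_ball (hsub hz) (sub_nonneg.2 ht.2.le) (by linarith [ht.1])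
  · filter_upwards [ae_restrict_mem measurableSet_Ioo] with t ht z hz
    exact norm_convFactor_integrand_le hMA hMB ht hz

lemma ofReal_mem_ball {x r : ℝ} (hx : 0 ≤ x) (hxr : x < r) : (x : ℂ) ∈ Metric.ball (0 : ℂ) r := by
  rwa [mem_ball_zero_iff, Complex.norm_real, Real.norm_of_nonneg hx]

/-- The integrand of `convFactor` at real points. -/
noncomputable def convIntegrand (α β : ℝ) (A B : ℂ → ℂ) (x t : ℝ) : ℝ :=
  t ^ (α - 1) * (1 - t) ^ (β - 1) * ((A (x * t : ℝ)).re * (B (x * (1 - t) : ℝ)).re)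

lemma convIntegrand_eq (hA : HasPowerDensity μ α R A) (hB : HasPowerDensity ν β R B) {x : ℝ}
    (hx : 0 ≤ x) (hxR : x < R) {t : ℝ} (ht : t ∈ Set.Ioo (0 : ℝ) 1) :
    ((t ^ (α - 1) * (1 - t) ^ (β - 1) : ℝ) : ℂ) * (A (x * t) * B (x * (1 - t : ℝ))) =
      (convIntegrand α β A B x t : ℝ) := by
  have h1 : ∀ y : ℝ, 0 ≤ y → y < R → A y = ((A y).re : ℝ) := fun y hy hyR =>
    Complex.ext (by simp) (by simp [hA.im_eq_zero y hy hyR])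
  have h2 : ∀ y : ℝ, 0 ≤ y → y < R → B y = ((B y).re : ℝ) := fun y hy hyR =>
    Complex.ext (by simp) (by simp [hB.im_eq_zero y hy hyR])
  have t0 := ht.1
  have t1 := ht.2
  rw [← Complex.ofReal_mul, ← Complex.ofReal_mul, h1 (x * t) (by positivity) (by nlinarith),
    h2 (x * (1 - t)) (mul_nonneg hx (by linarith)) (by nlinarith)]
  simp only [convIntegrand]
  push_cast
  ring

lemma convIntegrand_nonneg (hA : HasPowerDensity μ α R A) (hB : HasPowerDensity ν β R B) {x : ℝ}
    (hx : 0 ≤ x) (hxR : x < R) {t : ℝ} (ht : t ∈ Set.Ioo (0 : ℝ) 1) :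
    0 ≤ convIntegrand α β A B x t := by
  have t0 := ht.1
  have t1 := ht.2
  refine mul_nonneg (mul_nonneg (Real.rpow_nonneg t0.le _) (Real.rpow_nonneg (by linarith) _))
    (mul_nonneg (hA.re_nonneg _ (by positivity) (by nlinarith)) (hB.re_nonneg _
      (mul_nonneg hx (by linarith)) (by nlinarith)))

lemma convFactor_ofReal (hA : HasPowerDensity μ α R A) (hB : HasPowerDensity ν β R B) {x : ℝ}
    (hx : 0 ≤ x) (hxR : x < R) :
    convFactor α β A B x = ((∫ t in Set.Ioo 0 1, convIntegrand α β A B x t : ℝ) : ℂ) := by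
  rw [convFactor, ← integral_complex_ofReal]
  exact setIntegral_congr_fun measurableSet_Ioo fun t ht => convIntegrand_eq hA hB hx hxR ht

lemma integrableOn_convIntegrand (hα : 0 < α) (hβ : 0 < β) (hA : HasPowerDensity μ α R A)
    (hB : HasPowerDensity ν β R B) {x : ℝ} (hx : 0 ≤ x) (hxR : x < R) :
    IntegrableOn (convIntegrand α β A B x) (Set.Ioo 0 1) := by
  obtain ⟨r, hxr, hr⟩ := exists_between hxR
  obtain ⟨MA, hMA⟩ := hA.exists_norm_le hr
  obtain ⟨MB, hMB⟩ := hB.exists_norm_le hr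
  have h1 := ((integrableOn_beta hα hβ).mul_const (MA * MB)).mono'
    (aestronglyMeasurable_convFactor_integrand hA hB (ofReal_mem_ball hx hxR)) (by
      filter_upwards [ae_restrict_mem measurableSet_Ioo] with t ht
      exact norm_convFactor_integrand_le hMA hMB ht (ofReal_mem_ball hx hxr))
  refine h1.re.congr ?_
  filter_upwards [ae_restrict_mem measurableSet_Ioo] with t ht
  rw [convIntegrand_eq hA hB hx hxR ht]
  exact Complex.ofReal_re _

/-- At 0 the factor is `A 0 * B 0` times a Beta integral with positive integrand. -/
lemma convFactor_zero_ne (hα : 0 < α) (hβ : 0 < β) (hA : A 0 ≠ 0) (hB : B 0 ≠ 0) :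
    convFactor α β A B 0 ≠ 0 := by
  simp only [convFactor, zero_mul]
  rw [integral_mul_const, integral_complex_ofReal]
  refine mul_ne_zero ?_ (mul_ne_zero hA hB)
  rw [Complex.ofReal_ne_zero]
  refine ne_of_gt ((setIntegral_pos_iff_support_of_nonneg_ae ?_ (integrableOn_beta hα hβ)).2 ?_)
  · filter_upwards [ae_restrict_mem measurableSet_Ioo] with t ht
    exact mul_nonneg (Real.rpow_nonneg ht.1.le _) (Real.rpow_nonneg (by linarith [ht.2]) _)
  · have : Set.Ioo (0 : ℝ) 1 ⊆
        Function.support (fun t : ℝ => t ^ (α - 1) * (1 - t) ^ (β - 1)) ∩ Set.Ioo 0 1 :=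
      fun t ht => ⟨mul_ne_zero (Real.rpow_pos_of_pos ht.1 _).ne'
        (Real.rpow_pos_of_pos (by linarith [ht.2]) _).ne', ht⟩
    exact lt_of_lt_of_le (by simp) (measure_mono this)

/-- Substituting `x = s t` extracts `s^(α-1) s^(β-1) s = s^(α+β-1)`; what remains is the integral
over `(0, 1)` defining `convFactor`. -/
lemma lintegral_density_mul_density (hα : 0 < α) (hβ : 0 < β) (hA : HasPowerDensity μ α R A)
    (hB : HasPowerDensity ν β R B) {s : ℝ} (hs : 0 < s) (hsR : s < R) :
    ∫⁻ x, density α R A x * density β R B (s - x) =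
      ENNReal.ofReal (s ^ (α + β - 1) * (convFactor α β A B s).re) := by
  have h1 : ∀ x, density α R A x * density β R B (s - x) =
      Set.indicator (Set.Ioo 0 s) (fun x => ENNReal.ofReal (x ^ (α - 1) * (A x).re) *
        ENNReal.ofReal ((s - x) ^ (β - 1) * (B (s - x : ℝ)).re)) x := by
    intro x
    by_cases hx : x ∈ Set.Ioo 0 s
    · have e1 : x ∈ Set.Ioo 0 R := ⟨hx.1, hx.2.trans hsR⟩
      have e2 : s - x ∈ Set.Ioo 0 R := ⟨by linarith [hx.2], by linarith [hx.1]⟩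
      rw [density, density, Set.indicator_of_mem hx, Set.indicator_of_mem e1,
        Set.indicator_of_mem e2]
    · rw [Set.indicator_of_notMem hx, density, density]
      by_cases hx0 : 0 < x
      · rw [Set.indicator_of_notMem (a := s - x), mul_zero]
        exact fun h => hx ⟨hx0, by linarith [h.1]⟩
      · rw [Set.indicator_of_notMem (a := x), zero_mul]
        exact fun h => hx0 h.1
  have himg : (fun t => s * t) '' Set.Ioo 0 1 = Set.Ioo 0 s := by
    rw [Set.image_mul_left_Ioo hs, mul_zero, mul_one]
  rw [lintegral_congr h1, lintegral_indicator measurableSet_Ioo, ← himg,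
    lintegral_image_eq_lintegral_abs_deriv_mul measurableSet_Ioo (f' := fun _ => s)
      (fun x _ => by simpa using ((hasDerivAt_id x).const_mul s).hasDerivWithinAt)
      ((mul_right_injective₀ hs.ne').injOn), convFactor_ofReal hA hB hs.le hsR, Complex.ofReal_re,
    ← integral_const_mul, ofReal_integral_eq_lintegral_ofReal
      ((integrableOn_convIntegrand hα hβ hA hB hs.le hsR).const_mul _)]
  · refine setLIntegral_congr_fun measurableSet_Ioo fun t ht => ?_
    have t0 := ht.1
    have t1 : 0 < 1 - t := sub_pos.2 ht.2
    have hA0 := hA.re_nonneg (s * t) (by positivity) (by nlinarith)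
    have hB0 := hB.re_nonneg (s * (1 - t)) (by positivity) (by nlinarith)
    have e1 : s - s * t = s * (1 - t) := by ring
    rw [e1, abs_of_pos hs, ← ENNReal.ofReal_mul (by positivity), ← ENNReal.ofReal_mul (by positivity)]
    congr 1
    rw [Real.mul_rpow hs.le t0.le, Real.mul_rpow hs.le t1.le, convIntegrand,
      show α + β - 1 = 1 + (α - 1) + (β - 1) by ring, Real.rpow_add hs, Real.rpow_add hs,
      Real.rpow_one]
    ring
  · filter_upwards [ae_restrict_mem measurableSet_Ioo] with t ht
    exact mul_nonneg (Real.rpow_nonneg hs.le _) (convIntegrand_nonneg hA hB hs.le hsR ht)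

lemma conv [SFinite μ] [SFinite ν] (hα : 0 < α) (hβ : 0 < β) {R' : ℝ}
    (hA : HasPowerDensity μ α R A) (hB : HasPowerDensity ν β R' B) :
    ∃ r, HasPowerDensity (μ.conv ν) (α + β) r (convFactor α β A B) := by
  have hR : 0 < min R R' := lt_min hA.pos hB.pos
  replace hA := hA.mono hR (min_le_left _ _)
  replace hB := hB.mono hR (min_le_right _ _)
  -- Strict shrinking keeps `A` and `B` bounded on the smaller disc, which dominates the integral
  -- defining `convFactor`.
  obtain ⟨r, hr0, hr⟩ := exists_between hR
  have hC : ∀ x : ℝ, 0 ≤ x → x < r → convFactor α β A B x =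
      ((∫ t in Set.Ioo 0 1, convIntegrand α β A B x t : ℝ) : ℂ) := fun x hx hxr =>
    convFactor_ofReal hA hB hx (hxr.trans hr)
  refine ⟨r, hr0, differentiableOn_convFactor hα hβ hA hB hr, fun x hx hxr => ?_,
    fun x hx hxr => ?_, convFactor_zero_ne hα hβ hA.apply_zero_ne hB.apply_zero_ne,
    fun f hf hfr => ?_⟩
  · rw [hC x hx hxr, Complex.ofReal_im]
  · rw [hC x hx hxr, Complex.ofReal_re]
    exact setIntegral_nonneg measurableSet_Ioo fun t ht =>
      convIntegrand_nonneg hA hB hx (hxr.trans hr) ht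
  · rw [lintegral_conv_eq hA hB hf fun x hx => hfr x (hr.le.trans hx),
      ← lintegral_indicator measurableSet_Ioo]
    refine lintegral_congr fun s => ?_
    by_cases hs : s ∈ Set.Ioo 0 r
    · rw [Set.indicator_of_mem hs, lintegral_density_mul_density hα hβ hA hB hs.1 (hs.2.trans hr)]
    · rw [Set.indicator_of_notMem hs]
      by_cases hs0 : 0 < s
      · rw [hfr s (not_lt.1 fun h => hs ⟨hs0, h⟩), zero_mul]
      · have : ∀ x, density α (min R R') A x * density β (min R R') B (s - x) = 0 := fun x => by
          rw [density, density]
          by_cases hx0 : 0 < x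
          · rw [Set.indicator_of_notMem (a := s - x), mul_zero]
            exact fun h => by linarith [h.1]
          · rw [Set.indicator_of_notMem (a := x), zero_mul]
            exact fun h => hx0 h.1
        simp [this]

end HasPowerDensity

/-! ### Integration against a power density, and mass near 0 -/

namespace HasPowerDensity

variable {μ : Measure ℝ} {α R : ℝ} {H : ℂ → ℂ}

lemma restrict_Iio_eq (h : HasPowerDensity μ α R H) :
    μ.restrict (Set.Iio R) = volume.withDensity (density α R H) := by
  ext s hs
  rw [Measure.restrict_apply hs, withDensity_apply _ hs,
    ← lintegral_indicator_one (hs.inter measurableSet_Iio),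
    h.lintegral_eq_density (measurable_one.indicator (hs.inter measurableSet_Iio))
      (fun x hx => Set.indicator_of_notMem (fun hm => not_lt.2 hx hm.2) _),
    ← lintegral_indicator hs]
  refine lintegral_congr fun x => ?_
  by_cases hx : x < R
  · by_cases hxs : x ∈ s <;> simp [Set.indicator, hx, hxs]
  · have : density α R H x = 0 := Set.indicator_of_notMem (fun hm => hx hm.2) _
    simp [this, Set.indicator]

lemma setIntegral_Iio_eq (h : HasPowerDensity μ α R H) (f : ℝ → ℂ) :
    ∫ x in Set.Iio R, f x ∂μ = ∫ x in (0 : ℝ)..R, ((x ^ (α - 1) : ℝ) : ℂ) * H x * f x := by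
  rw [h.restrict_Iio_eq, integral_withDensity_eq_integral_toReal_smul h.measurable_density,
    intervalIntegral.integral_of_le h.pos.le, ← integral_Ioc_eq_integral_Ioo.symm,
    ← integral_indicator measurableSet_Ioo]
  · refine integral_congr_ae (ae_of_all _ fun x => ?_)
    by_cases hx : x ∈ Set.Ioo 0 R
    · simp only [density, Set.indicator_of_mem hx]
      have h1 : H x = ((H x).re : ℝ) :=
        Complex.ext (by simp) (by simp [h.im_eq_zero x hx.1.le hx.2])
      rw [ENNReal.toReal_ofReal (mul_nonneg (Real.rpow_nonneg hx.1.le _)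
        (h.re_nonneg x hx.1.le hx.2)), Complex.real_smul, Complex.ofReal_mul, ← h1]
    · simp [density, Set.indicator_of_notMem hx]
  · refine ae_of_all _ fun x => ?_
    by_cases hx : x ∈ Set.Ioo 0 R
    · simp [density, Set.indicator_of_mem hx]
    · simp [density, Set.indicator_of_notMem hx]

lemma apply_zero_re_pos (h : HasPowerDensity μ α R H) : 0 < (H 0).re := by
  have h1 := h.re_nonneg 0 le_rfl h.pos
  have h2 := h.im_eq_zero 0 le_rfl h.pos
  rw [Complex.ofReal_zero] at h1 h2
  exact h1.lt_of_ne fun h0 => h.apply_zero_ne (Complex.ext h0.symm h2)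

/-- The density is positive just to the right of 0 because `H 0 > 0` and `H` is continuous. This
mass near 0 is what keeps the radius of convergence from exceeding `1 / S`. -/
lemma measure_Iio_pos (h : HasPowerDensity μ α R H) {δ : ℝ} (hδ : 0 < δ) :
    0 < μ (Set.Iio δ) := by
  have hR := h.pos
  have h0 : ∀ᶠ x : ℝ in 𝓝[≥] 0, 0 < (H x).re := by
    have hc : ContinuousWithinAt (fun x : ℝ => (H x).re) (Set.Ico 0 R) 0 :=
      Complex.continuous_re.continuousAt.comp_continuousWithinAt (h.continuousOn 0 ⟨le_rfl, hR⟩)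
    rw [ContinuousWithinAt, Complex.ofReal_zero] at hc
    have := hc.eventually (lt_mem_nhds h.apply_zero_re_pos)
    rwa [nhdsWithin_Ico_eq_nhdsGE hR] at this
  obtain ⟨ε, hε, hεH⟩ := mem_nhdsGE_iff_exists_Ico_subset.1 h0
  set r := min (min ε δ) R with hr
  have hr0 : 0 < r := lt_min (lt_min hε hδ) hR
  have hsub : Set.Ioo 0 r ⊆ Set.Iio δ := fun x hx =>
    hx.2.trans_le ((min_le_left _ _).trans (min_le_right _ _))
  refine lt_of_lt_of_le ?_ (measure_mono hsub)
  have hsub2 : Set.Ioo 0 r ⊆ Set.Iio R := fun x hx => hx.2.trans_le (min_le_right _ _)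
  rw [← Set.inter_eq_left.2 hsub2, ← Measure.restrict_apply measurableSet_Ioo, h.restrict_Iio_eq,
    withDensity_apply _ measurableSet_Ioo, setLIntegral_pos_iff h.measurable_density]
  have : Set.Ioo 0 r ⊆ Function.support (density α R H) ∩ Set.Ioo 0 r := by
    refine fun x hx => ⟨?_, hx⟩
    have hx' : x ∈ Set.Ioo 0 R := ⟨hx.1, hsub2 hx⟩
    rw [Function.mem_support, density, Set.indicator_of_mem hx']
    refine (ENNReal.ofReal_pos.2 (mul_pos (Real.rpow_pos_of_pos hx.1 _) (hεH ⟨hx.1.le, ?_⟩))).ne'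
    exact hx.2.trans_le ((min_le_left _ _).trans (min_le_left _ _))
  refine lt_of_lt_of_le ?_ (measure_mono this)
  simpa using hr0

end HasPowerDensity

/-! ### The arcsine law and sums of independent copies -/

/-- On the half period the map `x = 2a(1 - cos 2πθ)` is injective, and its derivative `4πa sin 2πθ`
equals `2π √(x (4a - x))`. -/
lemma lintegral_Ioo_comp_cos {a : ℝ} (ha : 0 < a) (f : ℝ → ℝ≥0∞) :
    ∫⁻ θ in Set.Ioo (0 : ℝ) (1 / 2), f (2 * a * (1 - Real.cos (2 * Real.pi * θ))) =
      ∫⁻ x in Set.Ioo 0 (4 * a), f x *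
        ENNReal.ofReal (1 / (2 * Real.pi * √(x * (4 * a - x)))) := by
  have hpi := Real.pi_pos
  set X : ℝ → ℝ := fun θ => 2 * a * (1 - Real.cos (2 * Real.pi * θ)) with hX
  have hmem : ∀ θ ∈ Set.Ioo (0 : ℝ) (1 / 2), 2 * Real.pi * θ ∈ Set.Ioo 0 Real.pi := fun θ hθ =>
    ⟨by have := hθ.1; positivity, by nlinarith [hθ.2]⟩
  have hinj : Set.InjOn X (Set.Ioo 0 (1 / 2)) := by
    intro x hx y hy hxy
    have h1 : Real.cos (2 * Real.pi * x) = Real.cos (2 * Real.pi * y) := by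
      have : 2 * a ≠ 0 := by positivity
      have := mul_left_cancel₀ this hxy
      linarith
    have := Real.injOn_cos (Set.Ioo_subset_Icc_self (hmem x hx))
      (Set.Ioo_subset_Icc_self (hmem y hy)) h1
    have h2 : 2 * Real.pi ≠ 0 := by positivity
    exact mul_left_cancel₀ h2 this
  have himg : X '' Set.Ioo 0 (1 / 2) = Set.Ioo 0 (4 * a) := by
    ext x
    constructor
    · rintro ⟨θ, hθ, rfl⟩
      have h1 := hmem θ hθ
      have h2 : Real.cos (2 * Real.pi * θ) < 1 := by
        rw [← Real.cos_zero]
        exact Real.cos_lt_cos_of_nonneg_of_le_pi le_rfl h1.2.le h1.1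
      have h3 : -1 < Real.cos (2 * Real.pi * θ) := by
        rw [← Real.cos_pi]
        exact Real.cos_lt_cos_of_nonneg_of_le_pi h1.1.le le_rfl h1.2
      simp only [hX]
      constructor <;> nlinarith
    · rintro ⟨hx0, hx1⟩
      have h1 : x / (2 * a) < 2 := by rw [div_lt_iff₀ (by positivity)]; linarith
      have h2 : 0 < x / (2 * a) := by positivity
      refine ⟨Real.arccos (1 - x / (2 * a)) / (2 * Real.pi), ⟨?_, ?_⟩, ?_⟩
      · have := Real.arccos_pos.2 (show 1 - x / (2 * a) < 1 by linarith)
        positivity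
      · have := Real.arccos_lt_pi.2 (show -1 < 1 - x / (2 * a) by linarith)
        rw [div_lt_iff₀ (by positivity)]
        linarith
      · simp only [hX]
        rw [mul_div_cancel₀ _ (by positivity), Real.cos_arccos (by linarith) (by linarith)]
        field_simp
        ring
  have hder : ∀ θ ∈ Set.Ioo (0 : ℝ) (1 / 2), HasDerivWithinAt X
      (2 * a * (Real.sin (2 * Real.pi * θ) * (2 * Real.pi))) (Set.Ioo 0 (1 / 2)) θ := by
    intro θ _
    have h1 : HasDerivAt (fun θ : ℝ => 2 * Real.pi * θ) (2 * Real.pi) θ := by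
      simpa using (hasDerivAt_id θ).const_mul (2 * Real.pi)
    simpa using ((h1.cos.const_sub 1).const_mul (2 * a)).hasDerivWithinAt
  rw [← himg, lintegral_image_eq_lintegral_abs_deriv_mul measurableSet_Ioo hder hinj]
  refine setLIntegral_congr_fun measurableSet_Ioo fun θ hθ => ?_
  have hs := Real.sin_pos_of_mem_Ioo (hmem θ hθ)
  have hsq : X θ * (4 * a - X θ) = (2 * a * Real.sin (2 * Real.pi * θ)) ^ 2 := by
    simp only [hX]
    rw [mul_pow, Real.sin_sq]
    ring
  change f (X θ) = _
  rw [hsq, Real.sqrt_sq (by positivity), abs_of_pos (by positivity), mul_left_comm,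
    ← ENNReal.ofReal_mul (by positivity)]
  have : 2 * a * (Real.sin (2 * Real.pi * θ) * (2 * Real.pi)) *
      (1 / (2 * Real.pi * (2 * a * Real.sin (2 * Real.pi * θ)))) = 1 := by
    field_simp
  rw [this, ENNReal.ofReal_one, mul_one]

/-- The reflection `θ ↦ 1 - θ` exchanges the two half periods, which doubles the density. -/
lemma lintegral_Ioc_comp_cos {a : ℝ} (ha : 0 < a) (f : ℝ → ℝ≥0∞) :
    ∫⁻ θ in Set.Ioc (0 : ℝ) 1, f (2 * a * (1 - Real.cos (2 * Real.pi * θ))) =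
      ∫⁻ x in Set.Ioo 0 (4 * a), f x *
        ENNReal.ofReal (1 / (Real.pi * √(x * (4 * a - x)))) := by
  have hunion : Set.Ioc (0 : ℝ) (1 / 2) ∪ Set.Ioc (1 / 2) 1 = Set.Ioc 0 1 :=
    Set.Ioc_union_Ioc_eq_Ioc (by norm_num) (by norm_num)
  rw [← hunion, lintegral_union measurableSet_Ioc (Set.Ioc_disjoint_Ioc_of_le le_rfl),
    setLIntegral_congr (Ioo_ae_eq_Ioc (a := (0 : ℝ)) (b := 1 / 2)).symm,
    setLIntegral_congr (Ioo_ae_eq_Ioc (a := (1 / 2 : ℝ)) (b := 1)).symm]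
  have hrefl : ∀ θ : ℝ, (Set.Ioo (1 / 2 : ℝ) 1).indicator
      (fun θ => f (2 * a * (1 - Real.cos (2 * Real.pi * θ)))) (1 - θ) =
      (Set.Ioo (0 : ℝ) (1 / 2)).indicator
        (fun θ => f (2 * a * (1 - Real.cos (2 * Real.pi * θ)))) θ := by
    intro θ
    have h1 : 1 - θ ∈ Set.Ioo (1 / 2 : ℝ) 1 ↔ θ ∈ Set.Ioo (0 : ℝ) (1 / 2) := by
      simp only [Set.mem_Ioo]
      constructor <;> rintro ⟨h, h'⟩ <;> constructor <;> linarith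
    have h2 : Real.cos (2 * Real.pi * (1 - θ)) = Real.cos (2 * Real.pi * θ) := by
      rw [mul_sub, mul_one, Real.cos_two_pi_sub]
    by_cases hθ : θ ∈ Set.Ioo (0 : ℝ) (1 / 2)
    · rw [Set.indicator_of_mem hθ, Set.indicator_of_mem (h1.2 hθ), h2]
    · rw [Set.indicator_of_notMem hθ, Set.indicator_of_notMem fun h => hθ (h1.1 h)]
  have hsecond : ∫⁻ θ in Set.Ioo (1 / 2 : ℝ) 1, f (2 * a * (1 - Real.cos (2 * Real.pi * θ))) =
      ∫⁻ θ in Set.Ioo (0 : ℝ) (1 / 2), f (2 * a * (1 - Real.cos (2 * Real.pi * θ))) := by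
    rw [← lintegral_indicator measurableSet_Ioo, ← lintegral_indicator measurableSet_Ioo,
      ← lintegral_sub_left_eq_self _ (1 : ℝ)]
    exact lintegral_congr hrefl
  rw [hsecond, lintegral_Ioo_comp_cos ha, ← two_mul,
    ← lintegral_const_mul' _ _ (by simp)]
  refine setLIntegral_congr_fun measurableSet_Ioo fun x hx => ?_
  change 2 * (f x * _) = _
  rw [mul_left_comm, ← ENNReal.ofReal_ofNat 2, ← ENNReal.ofReal_mul (by norm_num)]
  congr 2
  have h1 : 0 < 4 * a - x := by linarith [hx.2]
  have h2 : 0 < √(x * (4 * a - x)) := Real.sqrt_pos.2 (mul_pos hx.1 h1)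
  have := Real.pi_pos
  field_simp

/-- The law of `2a(1 - cos(2πθ))` for a uniform angle `θ`. -/
lemma hasPowerDensity_cos {a : ℝ} (ha : 0 < a) :
    HasPowerDensity ((volume.restrict (Set.Ioc (0 : ℝ) 1)).map
      fun θ => 2 * a * (1 - Real.cos (2 * Real.pi * θ))) (1 / 2) (4 * a)
      fun z => (1 / Real.pi : ℝ) * ((4 * a : ℝ) - z) ^ (-(1 / 2 : ℝ) : ℂ) := by
  have hpi := Real.pi_pos
  have hreal : ∀ x : ℝ, x < 4 * a →
      ((1 / Real.pi : ℝ) : ℂ) * (((4 * a : ℝ) : ℂ) - x) ^ (-(1 / 2 : ℝ) : ℂ) =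
      ((1 / Real.pi * (4 * a - x) ^ (-(1 / 2 : ℝ)) : ℝ) : ℂ) := fun x hx => by
    rw [← Complex.ofReal_sub, ← Complex.ofReal_neg, ← Complex.ofReal_cpow (by linarith),
      ← Complex.ofReal_mul]
  refine ⟨by positivity, ?_, fun x _ hx => ?_, fun x _ hx => ?_, ?_, fun f hf _ => ?_⟩
  · refine DifferentiableOn.const_mul (DifferentiableOn.cpow (by fun_prop) (by fun_prop)
      fun z hz => ?_) _
    rw [mem_ball_zero_iff] at hz
    left
    have := (Complex.re_le_norm z).trans_lt hz
    rw [Complex.sub_re, Complex.ofReal_re]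
    linarith
  · rw [hreal x hx, Complex.ofReal_im]
  · rw [hreal x hx, Complex.ofReal_re]
    have : 0 < 4 * a - x := by linarith
    positivity
  · have := hreal 0 (by positivity)
    rw [Complex.ofReal_zero] at this
    rw [this, Complex.ofReal_ne_zero, sub_zero]
    positivity
  · rw [lintegral_map hf (by fun_prop), lintegral_Ioc_comp_cos ha]
    refine setLIntegral_congr_fun measurableSet_Ioo fun x hx => ?_
    have h1 : 0 < 4 * a - x := by linarith [hx.2]
    change f x * _ = f x * _
    rw [hreal x hx.2, Complex.ofReal_re, Real.sqrt_mul hx.1.le, Real.sqrt_eq_rpow, Real.sqrt_eq_rpow,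
      Real.rpow_neg h1.le, show (1 / 2 : ℝ) - 1 = -(1 / 2) by norm_num, Real.rpow_neg hx.1.le]
    congr 2
    have := Real.rpow_pos_of_pos hx.1 (1 / 2)
    have := Real.rpow_pos_of_pos h1 (1 / 2)
    field_simp

instance isProbabilityMeasure_restrict_Ioc_zero_one :
    IsProbabilityMeasure (volume.restrict (Set.Ioc (0 : ℝ) 1)) :=
  ⟨by simp⟩

-- Distinct coordinates are independent under the product measure, so each new summand is a
-- convolution and adds `1/2` to the exponent.
open ProbabilityTheory in
lemma exists_hasPowerDensity_sum {d : ℕ} {a : Fin d → ℝ} (ha : ∀ i, 0 < a i) (s : Finset (Fin d))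
    (hs : s.Nonempty) :
    ∃ R H, HasPowerDensity ((Measure.pi fun _ : Fin d => volume.restrict (Set.Ioc (0 : ℝ) 1)).map
      (∑ i ∈ s, fun θ => 2 * a i * (1 - Real.cos (2 * Real.pi * θ i)))) (s.card / 2) R H := by
  have hsingle : ∀ i, HasPowerDensity
      ((Measure.pi fun _ : Fin d => volume.restrict (Set.Ioc (0 : ℝ) 1)).map
        fun θ => 2 * a i * (1 - Real.cos (2 * Real.pi * θ i))) (1 / 2) (4 * a i)
      fun z => (1 / Real.pi : ℝ) * ((4 * a i : ℝ) - z) ^ (-(1 / 2 : ℝ) : ℂ) := fun i => by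
    have h := hasPowerDensity_cos (ha i)
    rw [← (measurePreserving_eval (fun _ : Fin d => volume.restrict (Set.Ioc (0 : ℝ) 1)) i).map_eq,
      Measure.map_map (by fun_prop) (by fun_prop)] at h
    exact h
  have hind : iIndepFun (fun i (θ : Fin d → ℝ) => 2 * a i * (1 - Real.cos (2 * Real.pi * θ i)))
      (Measure.pi fun _ : Fin d => volume.restrict (Set.Ioc (0 : ℝ) 1)) :=
    iIndepFun_pi (X := fun i t => 2 * a i * (1 - Real.cos (2 * Real.pi * t)))
      fun i => by fun_prop
  induction hs using Finset.Nonempty.cons_induction with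
  | singleton i =>
    simp only [Finset.sum_singleton, Finset.card_singleton, Nat.cast_one]
    exact ⟨_, _, hsingle i⟩
  | cons i s hi hs ih =>
    obtain ⟨R, H, h⟩ := ih
    have hI := (hind.indepFun_finsetSum_of_notMem (fun i => by fun_prop) hi).symm
    have hm : Measurable (∑ j ∈ s, fun θ : Fin d → ℝ =>
        2 * a j * (1 - Real.cos (2 * Real.pi * θ j))) := by
      rw [Finset.sum_fn]
      fun_prop
    have hcard : (0 : ℝ) < s.card / 2 := by
      have := Finset.card_pos.2 hs
      positivity
    obtain ⟨r, hr⟩ := (hsingle i).conv (by norm_num) hcard h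
    rw [Finset.sum_cons, Finset.card_cons, hI.map_add_eq_map_conv_map (by fun_prop) hm,
      show ((s.card + 1 : ℕ) : ℝ) / 2 = 1 / 2 + s.card / 2 by push_cast; ring]
    exact ⟨r, _, hr⟩

/-! ### Return probabilities by tilting and Fourier inversion -/

section ReturnProb

variable {d : ℕ}

/-- The natural generators, indexed by direction and sign. -/
def signedGenerator (j : Fin d × Bool) : Fin d → ℤ :=
  if j.2 then Pi.single j.1 1 else -Pi.single j.1 1

lemma signedGenerator_injective : Function.Injective (signedGenerator (d := d)) := by
  rintro ⟨i, b⟩ ⟨i', b'⟩ h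
  have h1 := congrFun h i
  by_cases hi : i = i'
  · subst hi
    cases b <;> cases b' <;> simp [signedGenerator] at h1 ⊢
  · cases b <;> cases b' <;> simp [signedGenerator, hi] at h1

lemma range_signedGenerator : Set.range (signedGenerator (d := d)) = naturalGenerators d := by
  ext x
  simp only [Set.mem_range, Prod.exists, Bool.exists_bool, naturalGenerators, Set.mem_ofPred_eq,
    signedGenerator]
  refine exists_congr fun i => ?_
  simp only [Bool.false_eq_true, if_false, if_true]
  rw [or_comm, eq_comm, @eq_comm _ (-Pi.single i 1)]

lemma conv_apply_singleton (μ : Measure (Fin d → ℤ)) [SFinite μ] {π : Measure (Fin d → ℤ)}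
    [SFinite π] (hπ : IsNearestNeighbour π) (x : Fin d → ℤ) :
    (μ.conv π) {x} = ∑ j : Fin d × Bool, π {signedGenerator j} * μ {x - signedGenerator j} := by
  rw [Measure.conv_comm, ← lintegral_indicator_one (measurableSet_singleton x),
    Measure.lintegral_conv (Measurable.of_discrete), lintegral_countable',
    ← tsum_fintype (L := .unconditional _)]
  refine Eq.trans ?_
    (signedGenerator_injective.tsum_eq (f := fun y => π {y} * μ {x - y}) ?_).symm
  · refine tsum_congr fun y => ?_
    rw [mul_comm, ← lintegral_indicator_one (measurableSet_singleton (x - y))]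
    congr 1
    refine lintegral_congr fun u => ?_
    simp only [Set.indicator, Set.mem_singleton_iff, eq_sub_iff_add_eq, add_comm, Pi.one_apply]
  · intro y hy
    rw [range_signedGenerator, ← hπ]
    exact left_ne_zero_of_mul hy

instance convPower.isProbabilityMeasure (π : Measure (Fin d → ℤ)) [IsProbabilityMeasure π] :
    ∀ n, IsProbabilityMeasure (convPower π n)
  | 0 => inferInstanceAs (IsProbabilityMeasure (Measure.dirac 0))
  | n + 1 => by
    have := convPower.isProbabilityMeasure π n
    exact inferInstanceAs (IsProbabilityMeasure ((convPower π n).conv π))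

lemma convPower_succ_real_singleton {π : Measure (Fin d → ℤ)} [IsProbabilityMeasure π]
    (hπ : IsNearestNeighbour π) (n : ℕ) (x : Fin d → ℤ) :
    (convPower π (n + 1)).real {x} =
      ∑ j : Fin d × Bool, π.real {signedGenerator j} *
        (convPower π n).real {x - signedGenerator j} := by
  rw [measureReal_def, convPower, conv_apply_singleton _ hπ,
    ENNReal.toReal_sum fun j _ => ENNReal.mul_ne_top (measure_ne_top _ _) (measure_ne_top _ _)]
  simp only [ENNReal.toReal_mul, measureReal_def]

/-- The character `θ ↦ exp(2πi x·θ)`. -/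
noncomputable def latticeCharacter (x : Fin d → ℤ) (θ : Fin d → ℝ) : ℂ :=
  ∏ i, Complex.exp (2 * Real.pi * Complex.I * x i * θ i)

lemma latticeCharacter_add (x y : Fin d → ℤ) (θ : Fin d → ℝ) :
    latticeCharacter (x + y) θ = latticeCharacter x θ * latticeCharacter y θ := by
  simp only [latticeCharacter, ← Finset.prod_mul_distrib, ← Complex.exp_add]
  refine Finset.prod_congr rfl fun i _ => ?_
  rw [Pi.add_apply]
  push_cast
  ring_nf

lemma latticeCharacter_signedGenerator (i : Fin d) (b : Bool) (θ : Fin d → ℝ) :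
    latticeCharacter (signedGenerator (i, b)) θ =
      Complex.exp ((if b then 1 else -1) * (2 * Real.pi * θ i) * Complex.I) := by
  rw [latticeCharacter, Finset.prod_eq_single i]
  · cases b <;> simp [signedGenerator] <;> ring_nf
  · intro j _ hj
    cases b <;> simp [signedGenerator, hj]
  · simp

lemma continuous_latticeCharacter (x : Fin d → ℤ) : Continuous (latticeCharacter x) := by
  unfold latticeCharacter
  fun_prop

lemma norm_latticeCharacter (x : Fin d → ℤ) (θ : Fin d → ℝ) : ‖latticeCharacter x θ‖ = 1 := by
  rw [latticeCharacter, norm_prod]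
  refine Finset.prod_eq_one fun i _ => ?_
  rw [show (2 * Real.pi * Complex.I * x i * θ i : ℂ) =
    ((2 * Real.pi * x i * θ i : ℝ) : ℂ) * Complex.I by push_cast; ring,
    Complex.norm_exp_ofReal_mul_I]

lemma integral_exp_two_pi_int (n : ℤ) :
    ∫ t in Set.Ioc (0 : ℝ) 1, Complex.exp (2 * Real.pi * Complex.I * n * t) =
      if n = 0 then 1 else 0 := by
  split_ifs with hn
  · simp [hn]
  · have hc : (2 * Real.pi * Complex.I * n : ℂ) ≠ 0 := by
      simp [hn, Real.pi_ne_zero]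
    rw [← intervalIntegral.integral_of_le zero_le_one, integral_exp_mul_complex hc]
    have : Complex.exp (2 * Real.pi * Complex.I * n * (1 : ℝ)) = 1 := by
      rw [← Complex.exp_int_mul_two_pi_mul_I n]
      congr 1
      push_cast
      ring
    rw [this]
    simp

lemma integral_latticeCharacter (x : Fin d → ℤ) :
    ∫ θ, latticeCharacter x θ ∂(Measure.pi fun _ : Fin d => volume.restrict (Set.Ioc (0 : ℝ) 1)) =
      if x = 0 then 1 else 0 := by
  simp only [latticeCharacter]
  rw [integral_fintype_prod_eq_prod (𝕜 := ℂ)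
    (f := fun i (t : ℝ) => Complex.exp (2 * Real.pi * Complex.I * x i * t))]
  simp only [integral_exp_two_pi_int]
  split_ifs with hx
  · simp [hx]
  · obtain ⟨i, hi⟩ := Function.ne_iff.1 hx
    exact Finset.prod_eq_zero (Finset.mem_univ i) (if_neg hi)

lemma integrable_pow_mul_latticeCharacter (a : Fin d → ℝ) (n : ℕ) (x : Fin d → ℤ) :
    Integrable (fun θ => ((∑ i, 2 * a i * Real.cos (2 * Real.pi * θ i) : ℝ) : ℂ) ^ n *
      latticeCharacter x θ) (Measure.pi fun _ : Fin d => volume.restrict (Set.Ioc (0 : ℝ) 1)) := by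
  have hc := continuous_latticeCharacter x
  refine Integrable.of_bound (Continuous.aestronglyMeasurable (by fun_prop))
    ((∑ i, 2 * |a i|) ^ n) (ae_of_all _ fun θ => ?_)
  rw [norm_mul, norm_latticeCharacter, mul_one, norm_pow, Complex.norm_real]
  refine pow_le_pow_left₀ (norm_nonneg _) ((norm_sum_le _ _).trans (Finset.sum_le_sum fun i _ => ?_)) n
  rw [norm_mul, norm_mul, Real.norm_eq_abs, Real.norm_eq_abs, Real.norm_eq_abs, abs_two]
  exact mul_le_of_le_one_right (by positivity) (Real.abs_cos_le_one _)

/-- The exponential change of measure that symmetrises the walk. -/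
noncomputable def latticeWeight (r : Fin d → ℝ) (x : Fin d → ℤ) : ℝ := ∏ i, r i ^ x i

lemma latticeWeight_sub {r : Fin d → ℝ} (hr : ∀ i, 0 < r i) (x y : Fin d → ℤ) :
    latticeWeight r (x - y) = latticeWeight r x * (latticeWeight r y)⁻¹ := by
  simp only [latticeWeight, ← Finset.prod_inv_distrib, ← Finset.prod_mul_distrib, Pi.sub_apply]
  exact Finset.prod_congr rfl fun i _ => by rw [zpow_sub₀ (hr i).ne', div_eq_mul_inv]

lemma latticeWeight_signedGenerator (r : Fin d → ℝ) (i : Fin d) (b : Bool) :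
    latticeWeight r (signedGenerator (i, b)) = if b then r i else (r i)⁻¹ := by
  rw [latticeWeight, Finset.prod_eq_single i]
  · cases b <;> simp [signedGenerator]
  · intro j _ hj
    cases b <;> simp [signedGenerator, hj]
  · simp

/-- The weight is multiplicative, so in the convolution `latticeWeight r (x - y)` cancels the weight
carried by the step `y`, leaving the symmetric mass `a i`. The characters of `e_i` and `-e_i` then
add up to a cosine, giving one more factor of the cosine sum at each step. -/
lemma convPower_real_singleton_eq {π : Measure (Fin d → ℤ)} [IsProbabilityMeasure π]
    (hπ : IsNearestNeighbour π) {a r : Fin d → ℝ} (hr : ∀ i, 0 < r i)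
    (har : ∀ i b, π.real {signedGenerator (i, b)} =
      a i * latticeWeight r (signedGenerator (i, b))) (n : ℕ) (x : Fin d → ℤ) :
    ((convPower π n).real {x} : ℂ) = latticeWeight r x *
      ∫ θ, ((∑ i, 2 * a i * Real.cos (2 * Real.pi * θ i) : ℝ) : ℂ) ^ n * latticeCharacter (-x) θ
        ∂(Measure.pi fun _ : Fin d => volume.restrict (Set.Ioc (0 : ℝ) 1)) := by
  induction n generalizing x with
  | zero =>
    simp only [pow_zero, one_mul, integral_latticeCharacter, convPower, neg_eq_zero]
    by_cases hx : x = 0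
    · subst hx
      simp [measureReal_def, latticeWeight]
    · rw [if_neg hx, mul_zero, measureReal_def, Measure.dirac_apply' _ (measurableSet_singleton x),
        Set.indicator_of_notMem (by simpa using Ne.symm hx)]
      simp
  | succ n ih =>
    have hw : ∀ y, latticeWeight r y ≠ 0 := fun y =>
      (Finset.prod_pos fun i _ => zpow_pos (hr i) _).ne'
    have hterm : ∀ i b, ((π.real {signedGenerator (i, b)} *
        (convPower π n).real {x - signedGenerator (i, b)} : ℝ) : ℂ) = latticeWeight r x *
        ∫ θ, a i * (((∑ i, 2 * a i * Real.cos (2 * Real.pi * θ i) : ℝ) : ℂ) ^ n *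
          latticeCharacter (-x + signedGenerator (i, b)) θ)
          ∂(Measure.pi fun _ : Fin d => volume.restrict (Set.Ioc (0 : ℝ) 1)) := by
      intro i b
      have h0 : (latticeWeight r (signedGenerator (i, b)) : ℂ) ≠ 0 := by
        exact_mod_cast hw (signedGenerator (i, b))
      rw [integral_const_mul, Complex.ofReal_mul, ih, har, latticeWeight_sub hr, neg_sub,
        sub_eq_neg_add]
      push_cast
      field_simp
    rw [convPower_succ_real_singleton hπ, Complex.ofReal_sum, Fintype.sum_prod_type]
    simp_rw [hterm]
    rw [← Fintype.sum_prod_type (f := fun j : Fin d × Bool => (latticeWeight r x : ℂ) *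
        ∫ θ, a j.1 * (((∑ i, 2 * a i * Real.cos (2 * Real.pi * θ i) : ℝ) : ℂ) ^ n *
          latticeCharacter (-x + signedGenerator (j.1, j.2)) θ)
          ∂(Measure.pi fun _ : Fin d => volume.restrict (Set.Ioc (0 : ℝ) 1))),
      ← Finset.mul_sum, ← integral_finsetSum _
        fun j _ => (integrable_pow_mul_latticeCharacter a n _).const_mul _]
    congr 2
    funext θ
    have hcos : ∀ i, ((2 * a i * Real.cos (2 * Real.pi * θ i) : ℝ) : ℂ) =
        ∑ b, a i * latticeCharacter (signedGenerator (i, b)) θ := fun i => by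
      simp only [latticeCharacter_signedGenerator, Fintype.sum_bool, if_true, Bool.false_eq_true,
        if_false]
      push_cast
      rw [Complex.cos]
      ring_nf
    rw [pow_succ, Complex.ofReal_sum (f := fun i => 2 * a i * Real.cos (2 * Real.pi * θ i)),
      Fintype.sum_prod_type, Finset.mul_sum, Finset.sum_mul]
    refine Finset.sum_congr rfl fun i _ => ?_
    rw [hcos, Finset.mul_sum, Finset.sum_mul]
    refine Finset.sum_congr rfl fun b _ => ?_
    rw [latticeCharacter_add]
    ring

/-- The return probabilities are the moments of `S - Y`, where `Y` is supported on `[0, 2S]` and has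
a density with a power singularity at `0`. -/
lemma exists_returnProb_eq_integral (hd : 1 ≤ d) {π : Measure (Fin d → ℤ)} [IsProbabilityMeasure π]
    (hπ : IsNearestNeighbour π) :
    ∃ (μ : Measure ℝ) (S R : ℝ) (H : ℂ → ℂ), IsProbabilityMeasure μ ∧ 0 < S ∧
      HasPowerDensity μ (d / 2) R H ∧ (∀ᵐ s ∂μ, |S - s| ≤ S) ∧
      ∀ n, returnProb π n = ∫ s, (S - s) ^ n ∂μ := by
  have hp : ∀ i b, 0 < π.real {signedGenerator (d := d) (i, b)} := fun i b => by
    refine ENNReal.toReal_pos ?_ (measure_ne_top _ _)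
    have : signedGenerator (i, b) ∈ {x | π {x} ≠ 0} := by
      rw [show {x | π {x} ≠ 0} = naturalGenerators d from hπ, ← range_signedGenerator]
      exact Set.mem_range_self _
    exact this
  set u : Fin d → ℝ := fun i => π.real {signedGenerator (i, true)} with hu
  set v : Fin d → ℝ := fun i => π.real {signedGenerator (i, false)} with hv
  have hu0 : ∀ i, 0 < u i := fun i => hp i true
  have hv0 : ∀ i, 0 < v i := fun i => hp i false
  -- The solution of `u = a r`, `v = a / r`: the tilt that makes the two opposite masses equal.
  set a : Fin d → ℝ := fun i => √(u i) * √(v i) with ha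
  set r : Fin d → ℝ := fun i => √(u i) / √(v i) with hr
  have ha0 : ∀ i, 0 < a i := fun i =>
    mul_pos (Real.sqrt_pos.2 (hu0 i)) (Real.sqrt_pos.2 (hv0 i))
  have hr0 : ∀ i, 0 < r i := fun i =>
    div_pos (Real.sqrt_pos.2 (hu0 i)) (Real.sqrt_pos.2 (hv0 i))
  have har : ∀ i b, π.real {signedGenerator (i, b)} =
      a i * latticeWeight r (signedGenerator (i, b)) := by
    intro i b
    have e1 := Real.mul_self_sqrt (hu0 i).le
    have e2 := Real.mul_self_sqrt (hv0 i).le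
    have e3 := (Real.sqrt_pos.2 (hu0 i)).ne'
    have e4 := (Real.sqrt_pos.2 (hv0 i)).ne'
    rw [latticeWeight_signedGenerator]
    cases b
    · change v i = _
      simp only [Bool.false_eq_true, if_false, ha, hr, inv_div]
      field_simp
      linarith
    · change u i = _
      simp only [if_true, ha, hr]
      field_simp
      linarith
  have : Nonempty (Fin d) := ⟨⟨0, hd⟩⟩
  obtain ⟨R, H, h⟩ := exists_hasPowerDensity_sum ha0 Finset.univ Finset.univ_nonempty
  rw [Finset.card_univ, Fintype.card_fin] at h
  have hm : Measurable (∑ i, fun θ : Fin d → ℝ => 2 * a i * (1 - Real.cos (2 * Real.pi * θ i))) := by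
    rw [Finset.sum_fn]
    fun_prop
  have hS : ∀ θ : Fin d → ℝ, (∑ i, 2 * a i) -
      (∑ i, fun θ : Fin d → ℝ => 2 * a i * (1 - Real.cos (2 * Real.pi * θ i))) θ =
      ∑ i, 2 * a i * Real.cos (2 * Real.pi * θ i) := fun θ => by
    rw [Finset.sum_apply, ← Finset.sum_sub_distrib]
    exact Finset.sum_congr rfl fun i _ => by ring
  refine ⟨_, ∑ i, 2 * a i, R, H, Measure.isProbabilityMeasure_map hm.aemeasurable,
    Finset.sum_pos (fun i _ => by have := ha0 i; positivity) Finset.univ_nonempty, h, ?_,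
    fun n => ?_⟩
  · rw [ae_map_iff hm.aemeasurable (measurableSet_le (by fun_prop) measurable_const)]
    refine ae_of_all _ fun θ => ?_
    rw [hS]
    refine (Finset.abs_sum_le_sum_abs _ _).trans (Finset.sum_le_sum fun i _ => ?_)
    have := ha0 i
    rw [abs_mul, abs_of_pos (by positivity : 0 < 2 * a i)]
    exact mul_le_of_le_one_right (by positivity) (Real.abs_cos_le_one _)
  · rw [integral_map hm.aemeasurable (Measurable.aestronglyMeasurable (by fun_prop))]
    simp_rw [hS]
    have h1 := convPower_real_singleton_eq hπ hr0 har n 0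
    have h2 : ∀ θ : Fin d → ℝ, latticeCharacter 0 θ = 1 := fun θ => by simp [latticeCharacter]
    have h3 : latticeWeight r 0 = 1 := by simp [latticeWeight]
    simp only [neg_zero, h2, mul_one, h3, Complex.ofReal_one, one_mul, ← Complex.ofReal_pow] at h1
    rw [integral_complex_ofReal] at h1
    exact Complex.ofReal_injective h1

end ReturnProb

/-! ### Moment generating functions as Cauchy transforms -/

section Moments

variable {μ : Measure ℝ} [IsProbabilityMeasure μ] {S α R : ℝ} {H : ℂ → ℂ}

lemma integrable_sub_pow (hS : ∀ᵐ s ∂μ, |S - s| ≤ S) (n : ℕ) :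
    Integrable (fun s => (S - s) ^ n) μ := by
  refine Integrable.of_bound (Measurable.aestronglyMeasurable (by fun_prop)) (S ^ n) ?_
  filter_upwards [hS] with s hs
  rw [norm_pow, Real.norm_eq_abs]
  exact pow_le_pow_left₀ (abs_nonneg _) hs n

lemma abs_integral_sub_pow_le (hS : ∀ᵐ s ∂μ, |S - s| ≤ S) (n : ℕ) :
    |∫ s, (S - s) ^ n ∂μ| ≤ S ^ n := by
  have := norm_integral_le_of_norm_le_const (μ := μ) (f := fun s => (S - s) ^ n) (C := S ^ n) (by
    filter_upwards [hS] with s hs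
    rw [norm_pow, Real.norm_eq_abs]
    exact pow_le_pow_left₀ (abs_nonneg _) hs n)
  simpa using this

/-- For every `w` with `0 < w < S` the even moments are at least `w^(2n)` times the positive mass of
`(-∞, S - w)`. Even moments are used because odd ones may cancel. The bound limits both the radius
and the points of convergence. -/
lemma le_inv_of_moment_bound (hS0 : 0 < S) (h : HasPowerDensity μ α R H)
    (hS : ∀ᵐ s ∂μ, |S - s| ≤ S) {t C : ℝ}
    (hC : ∀ n : ℕ, |∫ s, (S - s) ^ n ∂μ| * t ^ n ≤ C) : t ≤ S⁻¹ := by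
  by_contra! ht
  have ht0 : 0 < t := (inv_pos.2 hS0).trans ht
  have htS : t⁻¹ < S := (inv_lt_comm₀ hS0 ht0).1 ht
  obtain ⟨w, hw, hwS⟩ := exists_between htS
  have hw0 : 0 < w := (inv_pos.2 ht0).trans hw
  have hm : 0 < μ.real (Set.Iio (S - w)) :=
    ENNReal.toReal_pos (h.measure_Iio_pos (sub_pos.2 hwS)).ne' (measure_ne_top _ _)
  have hlow : ∀ n : ℕ, μ.real (Set.Iio (S - w)) * w ^ (2 * n) ≤ ∫ s, (S - s) ^ (2 * n) ∂μ := by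
    intro n
    have h1 : ∫ _ in Set.Iio (S - w), w ^ (2 * n) ∂μ ≤
        ∫ s in Set.Iio (S - w), (S - s) ^ (2 * n) ∂μ := by
      refine setIntegral_mono_on (integrable_const _) (integrable_sub_pow hS _).integrableOn
        measurableSet_Iio fun s hs => ?_
      rw [Set.mem_Iio] at hs
      exact pow_le_pow_left₀ hw0.le (by linarith) _
    have h2 := setIntegral_le_integral (s := Set.Iio (S - w)) (integrable_sub_pow hS (2 * n))
      (ae_of_all _ fun s => (even_two_mul n).pow_nonneg _)
    rw [setIntegral_const, smul_eq_mul] at h1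
    exact h1.trans h2
  have hwt : 1 < w * t := by rwa [inv_lt_iff_one_lt_mul₀ ht0] at hw
  obtain ⟨n, hn⟩ := pow_unbounded_of_one_lt (C / μ.real (Set.Iio (S - w)))
    (show 1 < (w * t) ^ 2 from one_lt_pow₀ hwt two_ne_zero)
  rw [div_lt_iff₀ hm] at hn
  have h3 := hC (2 * n)
  have h4 := mul_le_mul_of_nonneg_right ((hlow n).trans (le_abs_self _)) (pow_nonneg ht0.le (2 * n))
  rw [← pow_mul, mul_pow] at hn
  linarith

/-- The generating function of the moments as a Cauchy transform. -/
lemma tsum_moment_eq (hS0 : 0 < S) (hS : ∀ᵐ s ∂μ, |S - s| ≤ S) {z : ℂ} (hz0 : z ≠ 0)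
    (hz : ‖z‖ < S⁻¹) :
    Integrable (fun s : ℝ => ((z⁻¹ - S) + s)⁻¹) μ ∧
    ∑' n : ℕ, ((∫ s, (S - s) ^ n ∂μ : ℝ) : ℂ) * z ^ n = z⁻¹ * ∫ s, ((z⁻¹ - S) + s)⁻¹ ∂μ := by
  have hzS : ‖z‖ * S < 1 := by rwa [lt_inv_comm₀ (norm_pos_iff.2 hz0) hS0,
    lt_inv_comm₀ hS0 (norm_pos_iff.2 hz0), ← one_div, lt_div_iff₀ hS0] at hz
  have hnorm : ∀ᵐ s ∂μ, ‖(((S - s : ℝ) : ℂ) * z)‖ ≤ ‖z‖ * S := by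
    filter_upwards [hS] with s hs
    rw [norm_mul, Complex.norm_real, Real.norm_eq_abs, mul_comm]
    exact mul_le_mul_of_nonneg_left hs (norm_nonneg _)
  -- The Cauchy kernel at `z⁻¹ - S` is `z` times the sum of the geometric series in `(S - s) z`.
  have hid : ∀ s : ℝ, ((z⁻¹ - S) + s)⁻¹ = z * (1 - ((S - s : ℝ) : ℂ) * z)⁻¹ := fun s => by
    rw [show (z⁻¹ - S) + (s : ℂ) = z⁻¹ * (1 - ((S - s : ℝ) : ℂ) * z) by
      push_cast; field_simp; ring, mul_inv, inv_inv]
  have hF : ∀ n : ℕ, Integrable (fun s : ℝ => (((S - s : ℝ) : ℂ) * z) ^ n) μ := fun n => by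
    refine Integrable.of_bound (Measurable.aestronglyMeasurable (by fun_prop)) ((‖z‖ * S) ^ n) ?_
    filter_upwards [hnorm] with s hs
    rw [norm_pow]
    exact pow_le_pow_left₀ (norm_nonneg _) hs n
  constructor
  · refine Integrable.of_bound (Measurable.aestronglyMeasurable (by fun_prop))
      (‖z‖ * (1 - ‖z‖ * S)⁻¹) ?_
    filter_upwards [hnorm] with s hs
    rw [hid, norm_mul, norm_inv]
    have h1 := norm_sub_norm_le (1 : ℂ) (((S - s : ℝ) : ℂ) * z)
    rw [norm_one] at h1
    have h2 : 0 < 1 - ‖z‖ * S := by linarith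
    gcongr
    linarith
  · have hsum := hasSum_integral_of_summable_integral_norm hF (by
      refine Summable.of_nonneg_of_le (fun n => integral_nonneg fun s => norm_nonneg _) (fun n => ?_)
        (summable_geometric_of_lt_one (by positivity) hzS)
      have := norm_integral_le_of_norm_le_const (μ := μ)
        (f := fun s : ℝ => ‖(((S - s : ℝ) : ℂ) * z) ^ n‖) (C := (‖z‖ * S) ^ n) (by
          filter_upwards [hnorm] with s hs
          rw [norm_norm, norm_pow]
          exact pow_le_pow_left₀ (norm_nonneg _) hs n)
      rw [probReal_univ, mul_one] at this
      exact (le_abs_self _).trans this)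
    have hterm : ∀ n : ℕ, ∫ s, (((S - s : ℝ) : ℂ) * z) ^ n ∂μ =
        ((∫ s, (S - s) ^ n ∂μ : ℝ) : ℂ) * z ^ n := fun n => by
      simp only [mul_pow]
      rw [integral_mul_const, ← integral_complex_ofReal]
      simp
    simp_rw [hterm] at hsum
    rw [hsum.tsum_eq, ← integral_const_mul]
    refine integral_congr_ae ?_
    filter_upwards [hnorm] with s hs
    rw [tsum_geometric_of_norm_lt_one (hs.trans_lt hzS), hid, ← mul_assoc, inv_mul_cancel₀ hz0,
      one_mul]

lemma analyticAt_integral_Ici_inv_add {r : ℝ} (hr : 0 < r) :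
    AnalyticAt ℂ (fun z : ℂ => ∫ s in Set.Ici r, (z + s)⁻¹ ∂μ) 0 := by
  have hr2 : 0 < r / 2 := by positivity
  have hlow : ∀ s ∈ Set.Ici r, ∀ z ∈ Metric.ball (0 : ℂ) (r / 2), r / 2 ≤ ‖z + (s : ℂ)‖ := by
    intro s hs z hz
    rw [mem_ball_zero_iff] at hz
    have h1 := norm_sub_le_norm_add (s : ℂ) z
    rw [Complex.norm_real, Real.norm_of_nonneg (hr.le.trans hs), add_comm (s : ℂ) z] at h1
    have : r ≤ s := hs
    linarith
  refine DifferentiableOn.analyticAt (s := Metric.ball 0 (r / 2)) ?_ (Metric.ball_mem_nhds _ hr2)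
  refine differentiableOn_integral_of_norm_le Metric.isOpen_ball (b := fun _ => (r / 2)⁻¹)
    (integrable_const _) (fun z _ => Measurable.aestronglyMeasurable (by fun_prop)) ?_ ?_
  · filter_upwards [ae_restrict_mem measurableSet_Ici] with s hs
    refine DifferentiableOn.inv (by fun_prop) fun z hz h0 => ?_
    have := hlow s hs z hz
    rw [h0, norm_zero] at this
    linarith
  · filter_upwards [ae_restrict_mem measurableSet_Ici] with s hs z hz
    have := hlow s hs z hz
    rw [norm_inv]
    gcongr

/-- The Cauchy transform of a measure with a power density. -/
lemma HasPowerDensity.exists_integral_inv_add_eq {k : ℕ} (hk : 1 ≤ k)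
    (h : HasPowerDensity μ (k / 2) R H) :
    ∃ f g : ℂ → ℂ, AnalyticAt ℂ f 0 ∧ AnalyticAt ℂ g 0 ∧ g 0 ≠ 0 ∧
      ∀ᶠ z in 𝓝 (0 : ℂ), z ∈ Complex.slitPlane → Integrable (fun s : ℝ => (z + s)⁻¹) μ →
        ∫ s, (z + s)⁻¹ ∂μ = f z + g z * modelSingularity k z := by
  obtain ⟨r, hr0, hr⟩ := exists_between h.pos
  have hr' := h.mono hr0 hr.le
  obtain ⟨q, c, hq, hc, hqc⟩ :=
    integral_rpow_mul_holomorphic_mul_inv_eq hr0 hr h.differentiableOn hk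
  -- The mass in `[r, ∞)` stays away from the pole for small `z` and contributes only to the
  -- analytic part.
  refine ⟨fun z => (∫ s in Set.Ici r, (z + s)⁻¹ ∂μ) + q z, fun z => c * H (-z),
    (analyticAt_integral_Ici_inv_add hr0).add hq, ?_, ?_, ?_⟩
  · refine analyticAt_const.mul ?_
    have h1 : AnalyticAt ℂ H (-0) := by
      rw [neg_zero]; exact h.differentiableOn.analyticAt (Metric.ball_mem_nhds _ h.pos)
    exact h1.comp analyticAt_id.neg
  · simpa using ⟨hc, h.apply_zero_ne⟩
  · filter_upwards [hqc] with z hz hzs hint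
    rw [← integral_add_compl measurableSet_Iio hint, Set.compl_Iio,
      hr'.setIntegral_Iio_eq (fun s : ℝ => (z + s)⁻¹), hz hzs]
    ring

end Moments

/-! ### The model singularity under products and at the origin -/

lemma arg_add_arg_mem_Ioc {x w : ℂ} (hx : 0 < x.re) (hw : 0 < w.re) :
    x.arg + w.arg ∈ Set.Ioc (-Real.pi) Real.pi := by
  have h1 := abs_lt.1 (Complex.abs_arg_lt_pi_div_two_iff.2 (Or.inl hx))
  have h2 := abs_lt.1 (Complex.abs_arg_lt_pi_div_two_iff.2 (Or.inl hw))
  constructor <;> linarith [h1.1, h1.2, h2.1, h2.2]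

/-- The model singularity is multiplicative up to an analytic correction. -/
lemma modelSingularity_mul {k : ℕ} (hk : 1 ≤ k) {x w : ℂ} (hx : 0 < x.re) (hw : 0 < w.re) :
    modelSingularity k (x * w) = w ^ (((k : ℂ) - 2) / 2) * modelSingularity k x +
      if Odd k then 0 else w ^ (((k : ℂ) - 2) / 2) * Complex.log w * x ^ (k / 2 - 1) := by
  have hx0 : x ≠ 0 := fun h => by simp [h] at hx
  have hw0 : w ≠ 0 := fun h => by simp [h] at hw
  have hlog := Complex.log_mul hx0 hw0 (arg_add_arg_mem_Ioc hx hw)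
  have hpow : (x * w) ^ (((k : ℂ) - 2) / 2) =
      w ^ (((k : ℂ) - 2) / 2) * x ^ (((k : ℂ) - 2) / 2) := by
    rw [Complex.cpow_def_of_ne_zero (mul_ne_zero hx0 hw0), Complex.cpow_def_of_ne_zero hx0,
      Complex.cpow_def_of_ne_zero hw0, hlog, ← Complex.exp_add]
    ring_nf
  unfold modelSingularity
  rw [hpow, hlog]
  split_ifs with hodd
  · ring
  -- For even `k` the exponent is the natural number `m - 1`, so the cross term containing `log w`
  -- is polynomial in `x` and analytic.
  · obtain ⟨m, rfl⟩ := Nat.not_odd_iff_even.1 hodd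
    have h1 : m + m = 2 * (m - 1) + 2 := by omega
    have h2 : ((((m + m : ℕ) : ℂ) - 2) / 2) = ((m - 1 : ℕ) : ℂ) := by
      rw [h1]; push_cast; ring
    rw [h2, Complex.cpow_natCast x, show (m + m) / 2 - 1 = m - 1 by omega]
    ring

lemma continuousAt_modelSingularity (k : ℕ) {x : ℂ} (hx : x ∈ Complex.slitPlane) :
    ContinuousAt (modelSingularity k) x := by
  unfold modelSingularity
  split_ifs
  · exact continuousAt_id.cpow continuousAt_const hx
  · exact (continuousAt_id.cpow continuousAt_const hx).mul (continuousAt_id.clog hx)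

lemma ofReal_cpow_half {k : ℕ} {x : ℝ} (hx : 0 ≤ x) :
    (x : ℂ) ^ (((k : ℂ) - 2) / 2) = ((x ^ (((k : ℝ) - 2) / 2) : ℝ) : ℂ) := by
  rw [Complex.ofReal_cpow hx]
  push_cast
  rfl

/-- The value at 0 is 0 by the convention `0 ^ c = 0` for `c ≠ 0`. For even `k` the limit holds
because a positive power beats the logarithm. -/
lemma tendsto_modelSingularity_zero {k : ℕ} (hk : 3 ≤ k) :
    Tendsto (fun x : ℝ => modelSingularity k x) (𝓝[>] 0) (𝓝 (modelSingularity k 0)) := by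
  have he : 0 < ((k : ℝ) - 2) / 2 := by
    have : (3 : ℝ) ≤ k := by exact_mod_cast hk
    linarith
  have h0 : modelSingularity k 0 = 0 := by
    have h2 : (k : ℂ) - 2 ≠ 0 := by
      rw [sub_ne_zero]
      exact_mod_cast (by omega : k ≠ 2)
    simp [modelSingularity, Complex.zero_cpow (div_ne_zero h2 two_ne_zero)]
  rw [h0]
  by_cases hodd : Odd k
  · have h1 : Tendsto (fun x : ℝ => x ^ (((k : ℝ) - 2) / 2)) (𝓝[>] 0) (𝓝 0) := by
      have := (Real.continuousAt_rpow_const 0 (((k : ℝ) - 2) / 2) (Or.inr he.le)).tendsto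
      rw [Real.zero_rpow he.ne'] at this
      exact this.mono_left nhdsWithin_le_nhds
    have h2 := (Complex.continuous_ofReal.tendsto 0).comp h1
    rw [Complex.ofReal_zero] at h2
    refine h2.congr' ?_
    filter_upwards [self_mem_nhdsWithin] with x hx
    rw [modelSingularity, if_pos hodd, ofReal_cpow_half (le_of_lt hx)]
    rfl
  · have h2 := (Complex.continuous_ofReal.tendsto 0).comp (tendsto_log_mul_rpow_nhdsGT_zero he)
    rw [Complex.ofReal_zero] at h2
    refine h2.congr' ?_
    filter_upwards [self_mem_nhdsWithin] with x hx
    rw [modelSingularity, if_neg hodd, ofReal_cpow_half (le_of_lt hx), Function.comp_apply,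
      Complex.ofReal_mul, Complex.ofReal_log (le_of_lt hx), mul_comm]

/-- For `k = 1, 2` the singularity is `x^(-1/2)` or `log x`. This blow-up rules out convergence of
the series at the radius itself. -/
lemma tendsto_norm_modelSingularity_atTop {k : ℕ} (hk1 : 1 ≤ k) (hk : k < 3) :
    Tendsto (fun x : ℝ => ‖modelSingularity k x‖) (𝓝[>] 0) atTop := by
  interval_cases k
  · have h1 : Tendsto (fun x : ℝ => x ^ (1 / 2 : ℝ)) (𝓝[>] 0) (𝓝[>] 0) := by
      refine tendsto_nhdsWithin_iff.2 ⟨?_, ?_⟩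
      · have := (Real.continuousAt_rpow_const 0 (1 / 2) (Or.inr (by norm_num))).tendsto
        rw [Real.zero_rpow (by norm_num)] at this
        exact this.mono_left nhdsWithin_le_nhds
      · filter_upwards [self_mem_nhdsWithin] with x hx using Real.rpow_pos_of_pos hx _
    refine (tendsto_inv_nhdsGT_zero.comp h1).congr' ?_
    filter_upwards [self_mem_nhdsWithin] with x hx
    have hx' : 0 < x := hx
    rw [modelSingularity_one, show (1 / 2 : ℂ) = ((1 / 2 : ℝ) : ℂ) by norm_num,
      ← Complex.ofReal_cpow hx'.le, norm_inv, Complex.norm_real,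
      Real.norm_of_nonneg (Real.rpow_nonneg hx'.le _)]
    rfl
  · refine (tendsto_abs_atBot_atTop.comp Real.tendsto_log_nhdsGT_zero).congr' ?_
    filter_upwards [self_mem_nhdsWithin] with x hx
    rw [modelSingularity_two, ← Complex.ofReal_log (le_of_lt hx), Complex.norm_real]
    rfl

/-! ### Assembling the expansion at the radius of convergence -/

/-- Singular expansion inside the disc of convergence. -/
lemma exists_expansion_of_norm_lt {μ : Measure ℝ} [IsProbabilityMeasure μ] {S R : ℝ} {H : ℂ → ℂ}
    {d : ℕ} (hd : 1 ≤ d) (hS0 : 0 < S) (h : HasPowerDensity μ (d / 2) R H)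
    (hS : ∀ᵐ s ∂μ, |S - s| ≤ S) :
    ∃ f g : ℂ → ℂ, AnalyticAt ℂ f (S⁻¹ : ℝ) ∧ AnalyticAt ℂ g (S⁻¹ : ℝ) ∧ g (S⁻¹ : ℝ) ≠ 0 ∧
      ∀ᶠ z : ℂ in 𝓝 ((S⁻¹ : ℝ) : ℂ), ‖z‖ < S⁻¹ →
        ∑' n : ℕ, ((∫ s, (S - s) ^ n ∂μ : ℝ) : ℂ) * z ^ n =
          f z + g z * modelSingularity d ((S⁻¹ : ℝ) - z) := by
  obtain ⟨f₀, g₀, hf₀, hg₀, hg₀0, hfg⟩ := h.exists_integral_inv_add_eq hd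
  set ρ : ℂ := ((S⁻¹ : ℝ) : ℂ) with hρ
  have hSc : (S : ℂ) ≠ 0 := by exact_mod_cast hS0.ne'
  have hρS : ρ = (S : ℂ)⁻¹ := by rw [hρ, Complex.ofReal_inv]
  have hρ0 : ρ ≠ 0 := by rw [hρS]; exact inv_ne_zero hSc
  -- These satisfy `ε z = (ρ - z) * w z` with `w ρ = S² > 0`, so near `ρ` the branches in `ε` and in
  -- `ρ - z` differ by factors analytic at `ρ`.
  set ε : ℂ → ℂ := fun z => z⁻¹ - S with hε
  set w : ℂ → ℂ := fun z => S * z⁻¹ with hw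
  have hερ : ε ρ = 0 := by simp [hε, hρS]
  have hwρ : w ρ = ((S ^ 2 : ℝ) : ℂ) := by simp [hw, hρS, sq]
  have hinv : AnalyticAt ℂ (fun z : ℂ => z⁻¹) ρ := analyticAt_inv hρ0
  have hεa : AnalyticAt ℂ ε ρ := hinv.sub analyticAt_const
  have hwa : AnalyticAt ℂ w ρ := analyticAt_const.mul hinv
  have hwre : 0 < (w ρ).re := by rw [hwρ, Complex.ofReal_re]; positivity
  have hws : w ρ ∈ Complex.slitPlane := Or.inl hwre
  have hw0 : w ρ ≠ 0 := Complex.slitPlane_ne_zero hws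
  have hwc : AnalyticAt ℂ (fun z => w z ^ (((d : ℂ) - 2) / 2)) ρ := hwa.cpow analyticAt_const hws
  have hwl : AnalyticAt ℂ (fun z => Complex.log (w z)) ρ := hwa.clog hws
  have hf₀ε : AnalyticAt ℂ (fun z => f₀ (ε z)) ρ := hf₀.comp_of_eq hεa hερ
  have hg₀ε : AnalyticAt ℂ (fun z => g₀ (ε z)) ρ := hg₀.comp_of_eq hεa hερ
  refine ⟨fun z => z⁻¹ * (f₀ (ε z) + g₀ (ε z) *
      if Odd d then 0 else w z ^ (((d : ℂ) - 2) / 2) * Complex.log (w z) * (ρ - z) ^ (d / 2 - 1)),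
    fun z => z⁻¹ * (g₀ (ε z) * w z ^ (((d : ℂ) - 2) / 2)), ?_, hinv.mul (hg₀ε.mul hwc), ?_, ?_⟩
  · refine hinv.mul (hf₀ε.add (hg₀ε.mul ?_))
    split_ifs
    · exact analyticAt_const
    · exact (hwc.mul hwl).mul ((analyticAt_const.sub analyticAt_id).pow _)
  · refine mul_ne_zero (inv_ne_zero hρ0) (mul_ne_zero (by rwa [hερ]) ?_)
    rw [Complex.cpow_def_of_ne_zero hw0]
    exact Complex.exp_ne_zero _
  · have hεt : Tendsto ε (𝓝 ρ) (𝓝 0) := hερ ▸ hεa.continuousAt.tendsto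
    have hwre' : ∀ᶠ z in 𝓝 ρ, 0 < (w z).re :=
      (Complex.continuous_re.continuousAt.comp hwa.continuousAt).eventually (lt_mem_nhds hwre)
    filter_upwards [hεt.eventually hfg, hwre', eventually_ne_nhds hρ0] with z hz hwz hz0 hzn
    obtain ⟨hint, hsum⟩ := tsum_moment_eq hS0 hS hz0 hzn
    have hre : 0 < (ρ - z).re := by
      rw [hρ, Complex.sub_re, Complex.ofReal_re]
      linarith [Complex.re_le_norm z]
    have hεw : ε z = (ρ - z) * w z := by
      simp only [hε, hw, hρS]
      field_simp
    have hslit : ε z ∈ Complex.slitPlane := by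
      rw [hεw, Complex.mem_slitPlane_iff_arg]
      have hx0 : ρ - z ≠ 0 := fun h => by simp [h] at hre
      have hwz0 : w z ≠ 0 := fun h => by simp [h] at hwz
      refine ⟨?_, mul_ne_zero hx0 hwz0⟩
      rw [Complex.arg_mul hx0 hwz0 (arg_add_arg_mem_Ioc hre hwz)]
      have h1 := abs_lt.1 (Complex.abs_arg_lt_pi_div_two_iff.2 (Or.inl hre))
      have h2 := abs_lt.1 (Complex.abs_arg_lt_pi_div_two_iff.2 (Or.inl hwz))
      linarith [h1.2, h2.2]
    rw [hsum, hz hslit hint, hεw, modelSingularity_mul hd hre hwz, ← hεw]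
    ring

/-- A singular expansion inside the disc of convergence extends to the points of the boundary
circle at which the series converges. -/
lemma expansion_of_summable {c : ℕ → ℂ} {d : ℕ} (hd : 1 ≤ d) {ρ : ℝ} (hρ : 0 < ρ) {f g : ℂ → ℂ}
    {U : Set ℂ} (hU : IsOpen U) (hf : ContinuousOn f U) (hg : ContinuousOn g U)
    (hg0 : g ρ ≠ 0)
    (hfg : ∀ z ∈ U, ‖z‖ < ρ → ∑' n, c n * z ^ n = f z + g z * modelSingularity d (ρ - z))
    {z : ℂ} (hz : z ∈ U) (hzρ : ‖z‖ ≤ ρ) (hsum : Summable fun n => c n * z ^ n) :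
    ∑' n, c n * z ^ n = f z + g z * modelSingularity d (ρ - z) := by
  rcases hzρ.lt_or_eq with hlt | heq
  · exact hfg z hz hlt
  -- Abel's theorem along the radius to `z`: the sum at `z` is the limit of the expansion at `t * z`
  -- as `t ↑ 1`.
  have hAbel := Complex.tendsto_tsum_powerSeries_nhdsWithin_lt hsum.hasSum.tendsto_sum_nat
  rw [tendsto_map'_iff] at hAbel
  have htz : Tendsto (fun t : ℝ => (t : ℂ) * z) (𝓝[<] 1) (𝓝 z) := by
    have : Tendsto (fun t : ℝ => (t : ℂ) * z) (𝓝 1) (𝓝 (((1 : ℝ) : ℂ) * z)) :=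
      Continuous.tendsto (by fun_prop) 1
    rw [Complex.ofReal_one, one_mul] at this
    exact this.mono_left nhdsWithin_le_nhds
  have hAbel2 : Tendsto (fun t : ℝ => f (t * z) + g (t * z) * modelSingularity d (ρ - t * z))
      (𝓝[<] 1) (𝓝 (∑' n, c n * z ^ n)) := by
    refine hAbel.congr' ?_
    filter_upwards [htz.eventually (hU.mem_nhds hz), self_mem_nhdsWithin,
      mem_nhdsWithin_of_mem_nhds (lt_mem_nhds one_pos)] with t htU ht1 ht0
    have htn : ‖(t : ℂ) * z‖ < ρ := by
      rw [norm_mul, Complex.norm_real, Real.norm_of_nonneg (le_of_lt ht0), heq]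
      exact mul_lt_of_lt_one_left hρ ht1
    rw [← hfg _ htU htn]
    refine tsum_congr fun n => ?_
    simp only [mul_pow]
    ring
  have hft := ((hf.continuousAt (hU.mem_nhds hz)).tendsto.comp htz)
  have hgt := ((hg.continuousAt (hU.mem_nhds hz)).tendsto.comp htz)
  have huniq : Tendsto (fun t : ℝ => modelSingularity d (ρ - t * z)) (𝓝[<] 1)
      (𝓝 (modelSingularity d (ρ - z))) →
      ∑' n, c n * z ^ n = f z + g z * modelSingularity d (ρ - z) := fun h =>
    tendsto_nhds_unique hAbel2 (hft.add (hgt.mul h))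
  by_cases hzeq : z = ρ
  · subst hzeq
    have hx : Tendsto (fun t : ℝ => ρ - t * ρ) (𝓝[<] 1) (𝓝[>] 0) := by
      refine tendsto_nhdsWithin_iff.2 ⟨?_, ?_⟩
      · have : Tendsto (fun t : ℝ => ρ - t * ρ) (𝓝 1) (𝓝 (ρ - 1 * ρ)) :=
          Continuous.tendsto (by fun_prop) 1
        rw [one_mul, sub_self] at this
        exact this.mono_left nhdsWithin_le_nhds
      · filter_upwards [self_mem_nhdsWithin] with t ht
        have : t < 1 := ht
        simp only [Set.mem_Ioi]
        nlinarith
    by_cases hd3 : 3 ≤ d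
    · refine huniq ?_
      rw [sub_self]
      simpa [Function.comp_def] using (tendsto_modelSingularity_zero hd3).comp hx
    -- For `d ≤ 2` the Abel limit is finite and `g ρ ≠ 0`, so solving for the singular term would
    -- bound it near `ρ`, against its blow-up.
    · exfalso
      have h1 : Tendsto (fun t : ℝ => ‖modelSingularity d (ρ - t * ρ)‖) (𝓝[<] 1) atTop := by
        simpa [Function.comp_def] using
          (tendsto_norm_modelSingularity_atTop hd (not_le.1 hd3)).comp hx
      have h2 := ((hAbel2.sub hft).div hgt hg0).norm
      refine not_tendsto_nhds_of_tendsto_atTop h1 _ (h2.congr' ?_)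
      filter_upwards [hgt.eventually (isOpen_ne.mem_nhds hg0)] with t ht
      have ht' : g (t * ρ) ≠ 0 := ht
      simp only [Function.comp_apply, Pi.div_apply]
      congr 1
      field_simp
      ring
  · refine huniq ?_
    -- On the circle `|z| = ρ` only `z = ρ` has real part `ρ`; elsewhere `ρ - z` lies in the right
    -- half plane, where the principal branches are continuous.
    have hre : 0 < ((ρ : ℂ) - z).re := by
      rw [Complex.sub_re, Complex.ofReal_re, sub_pos]
      refine lt_of_le_of_ne ((Complex.re_le_norm z).trans heq.le) fun h => hzeq ?_
      have h1 : z.re = ‖z‖ := h.trans heq.symm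
      have h2 := Complex.re_eq_norm.1 h1
      rw [Complex.nonneg_iff] at h2
      exact Complex.ext (by simpa using h) (by simpa using h2.2.symm)
    have hcont := (continuousAt_modelSingularity d (Or.inl hre : (ρ : ℂ) - z ∈ Complex.slitPlane))
    exact hcont.tendsto.comp (htz.const_sub (ρ : ℂ))

/-- Singular expansion of the Green function of a nearest neighbour random walk on `ℤ^d` at its
radius of convergence `ρ`. Powers and logarithms are principal branches. -/
theorem proposition6p1 (d : ℕ) (hd : 1 ≤ d) (π : Measure (Fin d → ℤ)) [IsProbabilityMeasure π]
    (hπ : IsNearestNeighbour π) :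
    ∃ ρ : ℝ, 0 < ρ ∧ greenRadius π = ENNReal.ofReal ρ ∧
      ∃ f g : ℂ → ℂ, AnalyticAt ℂ f (ρ : ℂ) ∧ AnalyticAt ℂ g (ρ : ℂ) ∧ g (ρ : ℂ) ≠ 0 ∧
        ∀ᶠ z : ℂ in 𝓝 (ρ : ℂ), Summable (fun n : ℕ => (returnProb π n : ℂ) * z ^ n) →
          (Odd d → greenFunction π z =
            f z + g z * ((ρ : ℂ) - z) ^ (((d : ℂ) - 2) / 2)) ∧
          (Even d → greenFunction π z =
            f z + g z * ((ρ : ℂ) - z) ^ (((d : ℂ) - 2) / 2) * Complex.log ((ρ : ℂ) - z)) := by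
  obtain ⟨μ, S, R, H, hμ, hS0, h, hS, hret⟩ := exists_returnProb_eq_integral hd hπ
  obtain ⟨f, g, hf, hg, hg0, hfg⟩ := exists_expansion_of_norm_lt hd hS0 h hS
  simp only [← hret] at hfg
  have hbound : ∀ {t C : ℝ}, (∀ n : ℕ, |returnProb π n| * t ^ n ≤ C) → t ≤ S⁻¹ := fun hC =>
    le_inv_of_moment_bound hS0 h hS fun n => by rw [← hret]; exact hC n
  have hρ : 0 < S⁻¹ := inv_pos.2 hS0
  refine ⟨S⁻¹, hρ, ?_, f, g, hf, hg, hg0, ?_⟩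
  · refine le_antisymm (ENNReal.le_of_forall_nnreal_lt fun t ht => ?_) ?_
    · obtain ⟨C, _, hC⟩ := FormalMultilinearSeries.norm_mul_pow_le_of_lt_radius _ ht
      have : (t : ℝ) ≤ S⁻¹ := hbound (C := C) fun n => by
        have := hC n
        rwa [FormalMultilinearSeries.ofScalars_norm, Complex.norm_real, Real.norm_eq_abs] at this
      rw [← ENNReal.ofReal_coe_nnreal]
      exact ENNReal.ofReal_le_ofReal this
    · refine FormalMultilinearSeries.le_radius_of_bound _ 1 fun n => ?_
      rw [FormalMultilinearSeries.ofScalars_norm, Complex.norm_real, Real.norm_eq_abs, hret,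
        Real.coe_toNNReal _ hρ.le, inv_pow, ← div_eq_mul_inv, div_le_one (by positivity)]
      exact abs_integral_sub_pow_le hS n
  · have hev := hfg.and (hf.eventually_analyticAt.and hg.eventually_analyticAt)
    obtain ⟨U, hUsub, hU, hρU⟩ := mem_nhds_iff.1 hev
    filter_upwards [hU.mem_nhds hρU] with z hz hsum
    -- Summability bounds the terms, so the moment bound places `z` in the closed disc.
    have hzρ : ‖z‖ ≤ S⁻¹ := by
      obtain ⟨C, hC⟩ := hsum.tendsto_atTop_zero.norm.bddAbove_range
      refine hbound (C := C) fun n => ?_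
      have := hC ⟨n, rfl⟩
      simpa using this
    have key := expansion_of_summable hd hρ hU
      (fun z hz => (hUsub hz).2.1.continuousAt.continuousWithinAt)
      (fun z hz => (hUsub hz).2.2.continuousAt.continuousWithinAt) hg0
      (fun z hz => (hUsub hz).1) hz hzρ hsum
    refine ⟨fun hodd => ?_, fun heven => ?_⟩
    · rw [greenFunction, key, modelSingularity, if_pos hodd]
    · rw [greenFunction, key, modelSingularity, if_neg (Nat.not_odd_iff_even.2 heven), mul_assoc]
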